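/- Let $D$ be a compact metric space, $E\subset\mathbb C$ compact, and $F\subset\widehat{\mathbb C}=\mathbb C\cup\{\infty\}$ closed with $E\cap F=\emptyset$; let $'$ denote the complement in $\widehat{\mathbb C}$. Let $\lambda,\mu$ be finite Borel measures on $D,E$, let $\nu$ be a Borel measure on $F$, and let $1\le p\le\infty$. A function $h$ is analytic at $\infty$ if $h(1/\zeta)$ is analytic at $\zeta=0$. For $U\subset\widehat{\mathbb C}$ open, $H(U)$ is the set of functions $h$ analytic on $U$ with $h(\infty)=0$ if $\infty\in U$. The Bergman space $H^p_\nu(F)$ is the closure in $L^p_\nu(F)$ of the functions in $L^p_\nu(F)$ that are restrictions of some $h\in H(U)$, $U\supset F$ open. Let $K\in C(D\times E)$ have an extension $K\in C(D\times F')$ such that $K(x,\cdot)$ is analytic in $F'$ for each $x\in D$. For $G\in C(D\times E)$ let $\mathcal G:L^2_\mu(E)\to L^2_\lambda(D)$ be the operator $\mathcal G[g](x)=\int_E G(x,y)g(y)\,\mathrm d\mu(y)$; its rank is the dimension of its range. The Grothendieck dual $\mathcal K':H^p_\nu(F)\to L^2_\lambda(D)$ is the bounded operator given by $$\mathcal K'[h](x)=\frac1{2\pi\mathrm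 i}\int_\Gamma K(x,\xi)\,h(\xi)\,\mathrm d\xi$$ for every $h\in H(U)$ with $h|_F\in L^p_\nu(F)$, every open $U\supset F$ with $U\cap E=\emptyset$, and every finite sum $\Gamma\subset U\setminus F$ of rectifiable Jordan curves whose winding number is constant on $F$ and constant on $U'$ (it is $0$ at $\infty$) with $\mathrm{Ind}_\Gamma(F)-\mathrm{Ind}_\Gamma(U')=1$. If no such bounded operator exists, put $\|\mathcal K'\|=\infty$. (If $\infty\in F$ or $K(\cdot,\infty)=0$, the integral does not depend on $\Gamma$; if $\infty\notin F$ and $\nu$ is finite, existence of $\mathcal K'$ requires $K(\cdot,\infty)=0$ $\lambda$-almost everywhere.) The Cauchy–Zolotarev number is $$Z_n\big(L^2_\mu(E),L^p_\nu(F)\big)=\inf_{\phi}\left\|\frac{\phi(z)^{-1}\phi(y)}{y-z}\right\|_{L^2_\mu(E)\to L^p_\nu(F)}\in[0,\infty],$$ where $\phi$ runs over the nonzero rational functions with numerator and denominator of degree at most $n$ for which $\phi$ is finite $\mu$-a.e. on $E$ and $1/\phi$ is finite $\nu$-a.e. on $F$; the norm is that of the integral operator with the given kernel (taken as $0$ at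 $z=\infty$), and is $\infty$ if this operator is not defined by absolutely convergent integrals or not bounded. Then for every $n\ge1$ such that $Z_n(L^2_\mu(E),L^p_\nu(F))$ and $\|\mathcal K'\|_{H^p_\nu(F)\to L^2_\lambda(D)}$ are finite there is a kernel $K_n\in C(D\times E)$ of rank at most $n$ with $$\|\mathcal K-\mathcal K_n\|_{L^2_\mu(E)\to L^2_\lambda(D)}\le Z_n\big(L^2_\mu(E),L^p_\nu(F)\big)\,\|\mathcal K'\|_{H^p_\nu(F)\to L^2_\lambda(D)}.$$ -/

import Mathlib

open MeasureTheory Set Topology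
open scoped ENNReal NNReal

noncomputable section

/-! ### Integral operators with continuous kernel -/

section KernelOp

variable {X Y : Type*} [MetricSpace X] [CompactSpace X]
  [MetricSpace Y] [CompactSpace Y] [MeasurableSpace Y] [BorelSpace Y]

theorem integrable_kernel_mul (μ : Measure Y) [IsFiniteMeasure μ] (K : C(X × Y, ℂ))
    (g : Lp ℂ 2 μ) (x : X) : Integrable (fun y => K (x, y) * g y) μ := by
  have hg : Integrable (fun y => g y) μ := (Lp.memLp g).integrable (by norm_num)
  refine hg.bdd_mul (c := ‖K‖) ?_ ?_
  · exact (K.continuous.comp (by fun_prop : Continuous fun y : Y => (x, y))).aestronglyMeasurable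
  · exact Filter.Eventually.of_forall fun y => K.norm_coe_le_norm _

/-- The continuous function `x ↦ ∫ K(x,y) g(y) dμ(y)`. -/
def kernelFun (μ : Measure Y) [IsFiniteMeasure μ] (K : C(X × Y, ℂ)) (g : Lp ℂ 2 μ) : C(X, ℂ) where
  toFun x := ∫ y, K (x, y) * g y ∂μ
  continuous_toFun := by
    have hg : Integrable (fun y => g y) μ := (Lp.memLp g).integrable (by norm_num)
    refine continuous_of_dominated (bound := fun y => ‖K‖ * ‖g y‖) ?_ ?_ ?_ ?_
    · exact fun x => (integrable_kernel_mul μ K g x).aestronglyMeasurable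
    · intro x
      refine Filter.Eventually.of_forall fun y => ?_
      rw [norm_mul]
      exact mul_le_mul_of_nonneg_right (K.norm_coe_le_norm _) (norm_nonneg _)
    · exact hg.norm.const_mul _
    · refine Filter.Eventually.of_forall fun y => ?_
      exact (K.continuous.comp (by fun_prop : Continuous fun x : X => (x, y))).mul
        continuous_const

theorem norm_kernelFun_le (μ : Measure Y) [IsFiniteMeasure μ] (K : C(X × Y, ℂ)) (g : Lp ℂ 2 μ) :
    ‖kernelFun μ K g‖ ≤ ‖K‖ * (μ univ ^ (1 / 2 : ℝ)).toReal * ‖g‖ := by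
  have hg : Integrable (fun y => g y) μ := (Lp.memLp g).integrable (by norm_num)
  have h1 : ∫ y, ‖g y‖ ∂μ ≤ (μ univ ^ (1 / 2 : ℝ)).toReal * ‖g‖ := by
    have h2 := eLpNorm_le_eLpNorm_mul_rpow_measure_univ (μ := μ) (p := 1) (q := 2)
      (by norm_num) (Lp.aestronglyMeasurable g)
    have h3 : (1 / (1 : ℝ≥0∞).toReal - 1 / (2 : ℝ≥0∞).toReal) = (1 / 2 : ℝ) := by norm_num
    rw [h3] at h2
    have h4 : μ univ ^ (1 / 2 : ℝ) ≠ ⊤ :=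
      ENNReal.rpow_ne_top_of_nonneg (by norm_num) (measure_ne_top μ _)
    have h5 := ENNReal.toReal_mono (ENNReal.mul_ne_top (Lp.eLpNorm_ne_top g) h4) h2
    rw [ENNReal.toReal_mul, ← Lp.norm_def] at h5
    rw [integral_norm_eq_lintegral_enorm hg.aestronglyMeasurable, ← eLpNorm_one_eq_lintegral_enorm,
      mul_comm]
    exact h5
  refine (ContinuousMap.norm_le _ (by positivity)).2 fun x => ?_
  calc ‖∫ y, K (x, y) * g y ∂μ‖ ≤ ∫ y, ‖K‖ * ‖g y‖ ∂μ := by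
        refine norm_integral_le_of_norm_le (hg.norm.const_mul _)
          (Filter.Eventually.of_forall fun y => ?_)
        rw [norm_mul]
        exact mul_le_mul_of_nonneg_right (K.norm_coe_le_norm _) (norm_nonneg _)
    _ = ‖K‖ * ∫ y, ‖g y‖ ∂μ := integral_const_mul _ _
    _ ≤ ‖K‖ * ((μ univ ^ (1 / 2 : ℝ)).toReal * ‖g‖) :=
        mul_le_mul_of_nonneg_left h1 (norm_nonneg _)
    _ = _ := by ring

/-- The integral operator `L²_μ(Y) → L²_λ(X)`, `g ↦ ∫ K(·,y) g(y) dμ(y)`. -/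
def kernelOp [MeasurableSpace X] [BorelSpace X] (lam : Measure X) [IsFiniteMeasure lam] (μ : Measure Y) [IsFiniteMeasure μ]
    (K : C(X × Y, ℂ)) : Lp ℂ 2 μ →L[ℂ] Lp ℂ 2 lam :=
  (ContinuousMap.toLp 2 lam ℂ).comp <|
    LinearMap.mkContinuous
      { toFun := kernelFun μ K
        map_add' := fun g₁ g₂ => by
          ext x
          change ∫ y, K (x, y) * (g₁ + g₂ : Lp ℂ 2 μ) y ∂μ
            = (∫ y, K (x, y) * g₁ y ∂μ) + ∫ y, K (x, y) * g₂ y ∂μ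
          rw [← integral_add (integrable_kernel_mul μ K g₁ x) (integrable_kernel_mul μ K g₂ x)]
          refine integral_congr_ae ?_
          filter_upwards [Lp.coeFn_add g₁ g₂] with y hy
          rw [hy, Pi.add_apply, mul_add]
        map_smul' := fun c g => by
          ext x
          rw [RingHom.id_apply]
          change ∫ y, K (x, y) * (c • g : Lp ℂ 2 μ) y ∂μ = c * ∫ y, K (x, y) * g y ∂μ
          rw [← integral_const_mul]
          refine integral_congr_ae ?_
          filter_upwards [Lp.coeFn_smul c g] with y hy
          rw [hy, Pi.smul_apply, smul_eq_mul]
          ring }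
      (‖K‖ * (μ univ ^ (1 / 2 : ℝ)).toReal) (norm_kernelFun_le μ K)

end KernelOp

/-! ### The Riemann sphere -/

instance : MeasurableSpace (OnePoint ℂ) := borel _

instance : BorelSpace (OnePoint ℂ) := ⟨rfl⟩

/-- `ζ ↦ 1/ζ` as a map from `ℂ` to the sphere, with `1/0 = ∞`. -/
def sphereInv (ζ : ℂ) : OnePoint ℂ := if ζ = 0 then OnePoint.infty else ((ζ⁻¹ : ℂ) : OnePoint ℂ)

/-- Analyticity at a point of the sphere; at `∞` it is analyticity of `f(1/ζ)` at `ζ = 0`. -/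
def SphereAnalyticAt (f : OnePoint ℂ → ℂ) : OnePoint ℂ → Prop
  | none => AnalyticAt ℂ (fun ζ => f (sphereInv ζ)) 0
  | some w => AnalyticAt ℂ (fun ζ : ℂ => f (ζ : OnePoint ℂ)) w

/-- `H(U)`: functions analytic on `U` that vanish at `∞` if `∞ ∈ U`. -/
def MemH (U : Set (OnePoint ℂ)) (h : OnePoint ℂ → ℂ) : Prop :=
  (∀ z ∈ U, SphereAnalyticAt h z) ∧ (OnePoint.infty ∈ U → h OnePoint.infty = 0)

/-! ### Contours -/

/-- A rectifiable Jordan curve in `ℂ`, given by a Lipschitz parametrization on `[0,1]`. -/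
structure JordanCurve where
  toFun : ℝ → ℂ
  lipschitz : ∃ C : ℝ≥0, LipschitzOnWith C toFun (Icc 0 1)
  closed : toFun 0 = toFun 1
  injOn : InjOn toFun (Ico 0 1)

/-- A finite sum of rectifiable Jordan curves (with their orientations). -/
abbrev Contour := List JordanCurve

/-- `∫_Γ f(ξ) dξ`. -/
def Contour.integral (Γ : Contour) (f : ℂ → ℂ) : ℂ :=
  (Γ.map fun γ => ∫ t in (0 : ℝ)..1, f (γ.toFun t) * deriv γ.toFun t).sum

/-- The winding number of `Γ` about a point of the sphere off `Γ`; it is `0` about `∞`. -/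
def Contour.index (Γ : Contour) : OnePoint ℂ → ℂ
  | none => 0
  | some w => (2 * Real.pi * Complex.I)⁻¹ * Γ.integral fun ξ => (ξ - w)⁻¹

/-- `Γ ⊂ U \ F`, and the winding numbers of `Γ` are constant on `F` and on the complement of `U`,
with `Ind_Γ(F) - Ind_Γ(Uᶜ) = 1`. -/
def Contour.Admissible (Γ : Contour) (F U : Set (OnePoint ℂ)) : Prop :=
  (∀ γ ∈ Γ, ∀ t ∈ Icc (0 : ℝ) 1, (γ.toFun t : OnePoint ℂ) ∈ U \ F) ∧
  ∃ a : ℤ, (∀ z ∈ F, Γ.index z = a + 1) ∧ ∀ w ∉ U, Γ.index w = a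

/-! ### The Bergman space and the Grothendieck dual operator -/

/-- `H^p_ν(F)`: the closure in `L^p_ν(F)` of the functions analytic on (a neighbourhood of) `F`. -/
def bergman (F : Set (OnePoint ℂ)) (p : ℝ≥0∞) [Fact (1 ≤ p)] (ν : Measure F) :
    Submodule ℂ (Lp ℂ p ν) :=
  (Submodule.span ℂ {u : Lp ℂ p ν | ∃ (U : Set (OnePoint ℂ)) (h : OnePoint ℂ → ℂ),
    IsOpen U ∧ F ⊆ U ∧ MemH U h ∧ u =ᵐ[ν] (fun z : F => h z)}).topologicalClosure

/-- `𝒦'[h](x) = (2πi)⁻¹ ∫_Γ K(x,ξ) h(ξ) dξ`. -/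
def dualFun {D : Type*} (K : D → OnePoint ℂ → ℂ) (Γ : Contour) (h : OnePoint ℂ → ℂ) (x : D) : ℂ :=
  (2 * Real.pi * Complex.I)⁻¹ * Γ.integral fun ξ => K x (ξ : OnePoint ℂ) * h (ξ : OnePoint ℂ)

/-- `T` is the operator `𝒦' : H^p_ν(F) → L²_λ(D)`: on every `h` analytic in an open
neighbourhood `U` of `F`, with `U` disjoint from `E`, it is given by the contour integral over
any admissible `Γ ⊂ U \ F`. It is determined by this, because such `h` are dense. -/
def IsGrothendieckDual {D : Type*} [MeasurableSpace D] (E : Set ℂ) (F : Set (OnePoint ℂ)) (p : ℝ≥0∞) [Fact (1 ≤ p)]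
    (ν : Measure F) (lam : Measure D) (K : D → OnePoint ℂ → ℂ)
    (T : bergman F p ν →L[ℂ] Lp ℂ 2 lam) : Prop :=
  ∀ (U : Set (OnePoint ℂ)) (h : OnePoint ℂ → ℂ) (Γ : Contour) (u : bergman F p ν),
    IsOpen U → F ⊆ U → (∀ y ∈ E, (y : OnePoint ℂ) ∉ U) → MemH U h → Γ.Admissible F U →
    (u : Lp ℂ p ν) =ᵐ[ν] (fun z : F => h z) → T u =ᵐ[lam] dualFun K Γ h

/-- `‖𝒦'‖` as an operator `H^p_ν(F) → L²_λ(D)`; it is `∞` if `𝒦'` is not a (well-defined)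
bounded operator. -/
def dualNorm {D : Type*} [MeasurableSpace D] (E : Set ℂ) (F : Set (OnePoint ℂ)) (p : ℝ≥0∞) [Fact (1 ≤ p)]
    (ν : Measure F) (lam : Measure D) (K : D → OnePoint ℂ → ℂ) : ℝ≥0∞ :=
  ⨅ (T : bergman F p ν →L[ℂ] Lp ℂ 2 lam) (_ : IsGrothendieckDual E F p ν lam K T), ‖T‖ₑ

/-! ### Cauchy–Zolotarev numbers -/

/-- The kernel `φ(z)⁻¹ φ(y) / (y - z)`, which is `0` at `z = ∞`. -/
def zolotarevKernel (φ : RatFunc ℂ) : OnePoint ℂ → ℂ → ℂ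
  | none, _ => 0
  | some z, y => (φ.eval (RingHom.id ℂ) z)⁻¹ * φ.eval (RingHom.id ℂ) y / (y - z)

/-- `φ` does not vanish at the point `z` of the sphere (it may have a pole there). -/
def NonvanishingAt (φ : RatFunc ℂ) : OnePoint ℂ → Prop
  | none => φ.denom.natDegree ≤ φ.num.natDegree
  | some z => φ.num.eval z ≠ 0

/-- The norm of the integral operator `L²_μ(Y) → L^p_ν(X)` with kernel `k`: the least constant
`M ∈ [0,∞]`; it is `∞` unless the defining integrals converge absolutely for every `g ∈ L²`. -/
def kernelNorm {X Y : Type*} [MeasurableSpace X] [MeasurableSpace Y] (p : ℝ≥0∞)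
    (μ : Measure Y) (ν : Measure X) (k : X → Y → ℂ) : ℝ≥0∞ :=
  sInf {M : ℝ≥0∞ | ∀ g : Y → ℂ, MemLp g 2 μ →
    (∀ᵐ z ∂ν, Integrable (fun y => k z y * g y) μ) ∧
    eLpNorm (fun z => ∫ y, k z y * g y ∂μ) p ν ≤ M * eLpNorm g 2 μ}

/-- The Cauchy–Zolotarev number `Z_n(L²_μ(E), L^p_ν(F))`: the infimum is over the nonzero rational
functions of type `(n,n)` for which `φ` is finite almost everywhere on `E` and `1/φ` almost
everywhere on `F`, so that the kernel makes sense. -/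
def cauchyZolotarev (n : ℕ) (E : Set ℂ) (F : Set (OnePoint ℂ)) (p : ℝ≥0∞)
    (μ : Measure E) (ν : Measure F) : ℝ≥0∞ :=
  ⨅ (φ : RatFunc ℂ) (_ : φ ≠ 0 ∧ φ.num.natDegree ≤ n ∧ φ.denom.natDegree ≤ n ∧
      (∀ᵐ y : E ∂μ, φ.denom.eval (y : ℂ) ≠ 0) ∧ ∀ᵐ z : F ∂ν, NonvanishingAt φ z),
    kernelNorm p μ ν fun (z : F) (y : E) => zolotarevKernel φ z y

end

/-!
Let `C g` be the Cauchy transform `z ↦ ∫ g(y) / (y - z) dμ(y)`. By Cauchy's formula on a polygonal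
contour separating `E` from `F`, and Fubini, `𝒦 g = 𝒦' (C g)`. The kernel `φ(z)⁻¹ φ(y) / (y - z)`
of a rational function `φ` of type `(n, n)` differs from the Cauchy kernel by a kernel of rank at
most `n`. Hence, on a subspace of codimension at most `n`, `‖C g‖_p ≤ M ‖g‖` for every `M > Z_n`,
and there `‖𝒦 g‖ ≤ c' ‖g‖` for every `c' > c := Z_n ‖𝒦'‖`. As `𝒦` is compact, at most `n` of its
singular values exceed `c`, so truncating the singular value expansion leaves an error of norm at
most `c`. The truncated operator has a continuous kernel because the right singular vectors are in
the range of the adjoint of `𝒦`, which consists of continuous functions.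
-/

noncomputable section

section SingularSpace

open ContinuousLinearMap Module.End

theorem rank_iSup_le_of_directed {K V ι : Type*} [DivisionRing K] [AddCommGroup V] [Module K V]
    [Nonempty ι] {N : ι → Submodule K V} (hN : Directed (· ≤ ·) N) {n : ℕ}
    (hn : ∀ i, Module.rank K (N i) ≤ n) : Module.rank K (⨆ i, N i : Submodule K V) ≤ n := by
  refine rank_le fun s hs => ?_
  set b : s → V := fun v => (v : (⨆ i, N i : Submodule K V))
  have hb : LinearIndependent K b := hs.map' _ (Submodule.ker_subtype _)
  have hle : Submodule.span K (range b) ≤ ⨆ i, N i :=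
    Submodule.span_le.2 (range_subset_iff.2 fun v => v.1.2)
  obtain ⟨_, ⟨i, rfl⟩, hi⟩ := (Submodule.fg_iff_compact _).1 (Submodule.fg_span (finite_range b))
    _ _ (range_nonempty N) hN.directedOn_range isLUB_iSup hle
  have hcard : (s.card : Cardinal) ≤ n := by
    rw [← Fintype.card_coe, ← Cardinal.mk_fintype, ← Cardinal.mk_range_eq b hb.injective,
      ← rank_span hb]
    exact (Submodule.rank_mono hi).trans (hn i)
  exact_mod_cast hcard

variable {𝕜 H₁ H₂ : Type*} [RCLike 𝕜]
  [NormedAddCommGroup H₁] [InnerProductSpace 𝕜 H₁] [CompleteSpace H₁]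
  [NormedAddCommGroup H₂] [InnerProductSpace 𝕜 H₂] [CompleteSpace H₂]

theorem norm_le_of_forall_hasEigenvalue_norm_le {S : H₁ →L[𝕜] H₁}
    (hS : IsCompactOperator S) (hsymm : S.IsSymmetric) {r : ℝ} (hr : 0 ≤ r)
    (h : ∀ k, HasEigenvalue (S : Module.End 𝕜 H₁) k → ‖k‖ ≤ r) : ‖S‖ ≤ r := by
  lift r to ℝ≥0 using hr
  rw [← coe_nnnorm, NNReal.coe_le_coe, ← ENNReal.coe_le_coe,
    ← S.spectralRadius_eq_nnnorm hsymm.isSelfAdjoint]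
  refine iSup₂_le fun k hk => ENNReal.coe_le_coe.2 ?_
  rcases eq_or_ne k 0 with rfl | hk0
  · simp
  · exact h k ((hS.hasEigenvalue_iff_mem_spectrum hk0).2 hk)

theorem re_inner_adjoint_comp_self (T : H₁ →L[𝕜] H₂) (g : H₁) :
    RCLike.re (inner 𝕜 g ((adjoint T ∘L T) g)) = ‖T g‖ ^ 2 := by
  rw [comp_apply, adjoint_inner_right, inner_self_eq_norm_sq]

/-- The span of the right singular vectors of `T` whose squared singular value lies in `s`, that
is, of the eigenspaces of `T† T` with eigenvalue in `s`. -/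
def singularSpace (T : H₁ →L[𝕜] H₂) (s : Set ℝ) : Submodule 𝕜 H₁ :=
  ⨆ t : s, eigenspace ((adjoint T ∘L T : H₁ →L[𝕜] H₁) : Module.End 𝕜 H₁) ((t : ℝ) : 𝕜)

variable (T : H₁ →L[𝕜] H₂)

theorem eigenspace_le_singularSpace {s : Set ℝ} {t : ℝ} (ht : t ∈ s) :
    eigenspace ((adjoint T ∘L T : H₁ →L[𝕜] H₁) : Module.End 𝕜 H₁) (t : 𝕜) ≤ singularSpace T s :=
  le_iSup_of_le (⟨t, ht⟩ : s) le_rfl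

theorem singularSpace_mono {s t : Set ℝ} (h : s ⊆ t) : singularSpace T s ≤ singularSpace T t :=
  iSup_le fun a => eigenspace_le_singularSpace T (h a.2)

theorem singularSpace_Ioi (a : ℝ) :
    singularSpace T (Ioi a) = ⨆ m : Ioi a, singularSpace T (Ici (m : ℝ)) :=
  le_antisymm (iSup_mono fun _ => eigenspace_le_singularSpace T self_mem_Ici)
    (iSup_le fun m => singularSpace_mono T (Ici_subset_Ioi.2 m.2))

theorem singularSpace_le_range_adjoint {s : Set ℝ} (hs : 0 ∉ s) :
    singularSpace T s ≤ LinearMap.range (adjoint T : H₂ →ₗ[𝕜] H₁) := by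
  refine iSup_le fun t v hv => ?_
  have ht : ((t : ℝ) : 𝕜) ≠ 0 := RCLike.ofReal_ne_zero.2 fun h => hs (h ▸ t.2)
  have hTv : adjoint T (T v) = ((t : ℝ) : 𝕜) • v := mem_eigenspace_iff.1 hv
  exact ⟨((t : ℝ) : 𝕜)⁻¹ • T v, by rw [coe_coe, map_smul, hTv, inv_smul_smul₀ ht]⟩

theorem mul_norm_sq_le_of_mem_singularSpace {m : ℝ} {g : H₁}
    (hg : g ∈ singularSpace T (Ici m)) : m * ‖g‖ ^ 2 ≤ ‖T g‖ ^ 2 := by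
  obtain ⟨f, hf, rfl⟩ := (Submodule.mem_iSup_iff_exists_finsupp _ _).1 hg
  have hort := (isPositive_adjoint_comp_self T).isSymmetric.orthogonalFamily_eigenspaces.comp
    (γ := Ici m) (f := fun t => ((t : ℝ) : 𝕜)) (RCLike.ofReal_injective.comp Subtype.val_injective)
  let v : ∀ t : Ici m, eigenspace ((adjoint T ∘L T : H₁ →L[𝕜] H₁) : Module.End 𝕜 H₁)
    ((t : ℝ) : 𝕜) := fun t => ⟨f t, hf t⟩
  have hnorm : ‖f.sum fun _ x => x‖ ^ 2 = ∑ t ∈ f.support, ‖f t‖ ^ 2 := hort.norm_sum v f.support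
  have hT : ‖T (f.sum fun _ x => x)‖ ^ 2 = ∑ t ∈ f.support, (t : ℝ) * ‖f t‖ ^ 2 := by
    have happly : (adjoint T ∘L T) (f.sum fun _ x => x)
        = ∑ t ∈ f.support, (((t : ℝ) : 𝕜) • v t : H₁) := by
      rw [Finsupp.sum, map_sum]
      exact Finset.sum_congr rfl fun t _ => mem_eigenspace_iff.1 (hf t)
    have hinner := hort.inner_sum v (fun t => ((t : ℝ) : 𝕜) • v t) f.support
    rw [← re_inner_adjoint_comp_self, happly]
    refine (congrArg RCLike.re hinner).trans ?_
    rw [map_sum]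
    refine Finset.sum_congr rfl fun t _ => ?_
    rw [inner_smul_right, RCLike.re_ofReal_mul, inner_self_eq_norm_sq, Submodule.coe_norm]
  rw [hnorm, hT, Finset.mul_sum]
  exact Finset.sum_le_sum fun t _ => mul_le_mul_of_nonneg_right t.2 (sq_nonneg _)

theorem map_mem_orthogonal_singularSpace {s : Set ℝ} {v : H₁} (hv : v ∈ (singularSpace T s)ᗮ) :
    (adjoint T ∘L T) v ∈ (singularSpace T s)ᗮ := by
  rw [singularSpace, ← Submodule.iInf_orthogonal] at hv ⊢
  exact LinearMap.iInf_invariant _ (fun _ =>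
    (isPositive_adjoint_comp_self T).isSymmetric.invariant_orthogonalComplement_eigenspace _) v hv

theorem norm_adjoint_comp_self_le_of_mem_orthogonal (hT : IsCompactOperator T) {r : ℝ}
    (hr : 0 ≤ r) {g : H₁} (hg : g ∈ (singularSpace T (Ioi r))ᗮ) :
    ‖(adjoint T ∘L T) g‖ ≤ r * ‖g‖ := by
  have hpos := isPositive_adjoint_comp_self T
  have hinv : ∀ v ∈ (singularSpace T (Ioi r))ᗮ,
      (adjoint T ∘L T) v ∈ (singularSpace T (Ioi r))ᗮ := fun _ =>
    map_mem_orthogonal_singularSpace T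
  let S : (singularSpace T (Ioi r))ᗮ →L[𝕜] (singularSpace T (Ioi r))ᗮ :=
    (adjoint T ∘L T).restrict hinv
  have hS : IsCompactOperator S := (hT.clm_comp (adjoint T)).restrict' hinv
  have hsymm : S.IsSymmetric := hpos.isSymmetric.restrict_invariant hinv
  have hle : ‖S‖ ≤ r → ‖(adjoint T ∘L T) g‖ ≤ r * ‖g‖ := fun h => S.le_of_opNorm_le h ⟨g, hg⟩
  refine hle (norm_le_of_forall_hasEigenvalue_norm_le hS hsymm hr fun k hk => ?_)
  obtain ⟨t, rfl⟩ := RCLike.conj_eq_iff_real.1 (hsymm.conj_eigenvalue_eq_self hk)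
  have ht : 0 ≤ t := eigenvalue_nonneg_of_nonneg hk fun x =>
    (sq_nonneg ‖T x‖).trans_eq (re_inner_adjoint_comp_self T x).symm
  rw [RCLike.norm_ofReal, abs_of_nonneg ht]
  by_contra! hlt
  obtain ⟨v, hv, hv0⟩ := hk.exists_hasEigenvector
  have hmem : (v : H₁) ∈ singularSpace T (Ioi r) :=
    eigenspace_le_singularSpace T hlt
      (mem_eigenspace_iff.2 (congrArg Subtype.val (mem_eigenspace_iff.1 hv)))
  exact hv0 (Subtype.ext (inner_self_eq_zero.1 (v.2 v hmem)))

theorem norm_le_of_mem_orthogonal_singularSpace (hT : IsCompactOperator T) {c : ℝ} (hc : 0 ≤ c)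
    {g : H₁} (hg : g ∈ (singularSpace T (Ioi (c ^ 2)))ᗮ) : ‖T g‖ ≤ c * ‖g‖ := by
  refine le_of_sq_le_sq ?_ (by positivity)
  calc ‖T g‖ ^ 2 = RCLike.re (inner 𝕜 g ((adjoint T ∘L T) g)) :=
        (re_inner_adjoint_comp_self T g).symm
    _ ≤ ‖g‖ * ‖(adjoint T ∘L T) g‖ := re_inner_le_norm _ _
    _ ≤ ‖g‖ * (c ^ 2 * ‖g‖) := by
        gcongr
        exact norm_adjoint_comp_self_le_of_mem_orthogonal T hT (sq_nonneg c) hg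
    _ = (c * ‖g‖) ^ 2 := by ring

theorem rank_singularSpace_Ici_le {n : ℕ} {c m : ℝ} (hcm : c ^ 2 < m)
    (l : H₁ →ₗ[𝕜] (Fin n → 𝕜)) (hl : ∀ g, l g = 0 → ‖T g‖ ≤ c * ‖g‖) :
    Module.rank 𝕜 (singularSpace T (Ici m)) ≤ n := by
  have hinj : Function.Injective (l ∘ₗ (singularSpace T (Ici m)).subtype) := by
    refine (injective_iff_map_eq_zero _).2 fun g hg => ?_
    have hle : m * ‖(g : H₁)‖ ^ 2 ≤ c ^ 2 * ‖(g : H₁)‖ ^ 2 :=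
      calc m * ‖(g : H₁)‖ ^ 2 ≤ ‖T g‖ ^ 2 := mul_norm_sq_le_of_mem_singularSpace T g.2
        _ ≤ (c * ‖(g : H₁)‖) ^ 2 := pow_le_pow_left₀ (norm_nonneg _) (hl g hg) 2
        _ = c ^ 2 * ‖(g : H₁)‖ ^ 2 := mul_pow _ _ _
    by_contra hg0
    have hpos : 0 < ‖(g : H₁)‖ ^ 2 := by
      have : (g : H₁) ≠ 0 := fun h => hg0 (Subtype.ext h)
      positivity
    exact hcm.not_ge (le_of_mul_le_mul_right hle hpos)
  simpa using LinearMap.lift_rank_le_of_injective _ hinj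

theorem rank_singularSpace_Ioi_le {c : ℝ} (hc : 0 ≤ c) {n : ℕ}
    (h : ∀ c' > c, ∃ l : H₁ →ₗ[𝕜] (Fin n → 𝕜), ∀ g, l g = 0 → ‖T g‖ ≤ c' * ‖g‖) :
    Module.rank 𝕜 (singularSpace T (Ioi (c ^ 2))) ≤ n := by
  rw [singularSpace_Ioi]
  have : Nonempty (Ioi (c ^ 2)) := nonempty_Ioi.to_subtype
  refine rank_iSup_le_of_directed (directed_of_isDirected_ge
    fun (_ _ : Ioi (c ^ 2)) hab => singularSpace_mono T (Ici_subset_Ici.2 hab)) fun m => ?_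
  obtain ⟨c', hc', hm⟩ := exists_between (Real.lt_sqrt_of_sq_lt m.2)
  obtain ⟨l, hl⟩ := h c' hc'
  exact rank_singularSpace_Ici_le T ((Real.lt_sqrt (hc.trans hc'.le)).1 hm) l hl

end SingularSpace

section KernelOperators

open ContinuousLinearMap

theorem isCompact_closure_of_isBounded_of_equicontinuous {X β : Type*} [TopologicalSpace X]
    [CompactSpace X] [NormedAddCommGroup β] [ProperSpace β] {A : Set C(X, β)}
    (hA : Bornology.IsBounded A) (hequi : Equicontinuous ((↑) : A → X → β)) :
    IsCompact (closure A) := by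
  obtain ⟨r, hr⟩ := hA.exists_norm_le
  let e := ContinuousMap.isometryEquivBoundedOfCompact X β
  have hcompact : IsCompact (closure (e '' A)) := by
    refine BoundedContinuousFunction.arzela_ascoli (Metric.closedBall 0 r)
      (isCompact_closedBall _ _) _ ?_ ?_
    · rintro _ x ⟨f, hf, rfl⟩
      exact mem_closedBall_zero_iff.2 ((f.norm_coe_le_norm x).trans (hr f hf))
    · intro x₀ V hV
      filter_upwards [hequi x₀ V hV] with x hx
      rintro ⟨_, f, hf, rfl⟩
      exact hx ⟨f, hf⟩
  rw [← e.toHomeomorph.isCompact_image, e.toHomeomorph.image_closure]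
  exact hcompact

variable {X Y : Type*} [MetricSpace X] [CompactSpace X]
  [MetricSpace Y] [CompactSpace Y] [MeasurableSpace Y] [BorelSpace Y]
  (μ : Measure Y) [IsFiniteMeasure μ]

theorem integrable_coeFn_L2 {Z : Type*} [MeasurableSpace Z] {ρ : Measure Z} [IsFiniteMeasure ρ]
    (g : Lp ℂ 2 ρ) : Integrable g ρ :=
  (Lp.memLp g).integrable (by norm_num)

theorem integrable_continuousMap_mul {Z : Type*} [TopologicalSpace Z] [CompactSpace Z]
    [MeasurableSpace Z] [OpensMeasurableSpace Z] {ρ : Measure Z} (φ : C(Z, ℂ)) {g : Z → ℂ}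
    (hg : Integrable g ρ) : Integrable (fun z => φ z * g z) ρ :=
  hg.bdd_mul (c := ‖φ‖) φ.continuous.aestronglyMeasurable
    (Filter.Eventually.of_forall φ.norm_coe_le_norm)

theorem norm_integral_continuousMap_mul_le (φ : C(Y, ℂ)) (g : Lp ℂ 2 μ) :
    ‖∫ y, φ y * g y ∂μ‖ ≤ ‖φ‖ * (μ univ ^ (1 / 2 : ℝ)).toReal * ‖g‖ := by
  let K : C(PUnit.{1} × Y, ℂ) := φ.comp ⟨Prod.snd, continuous_snd⟩
  have hK : ‖K‖ ≤ ‖φ‖ := (K.norm_le (norm_nonneg _)).2 fun q => φ.norm_coe_le_norm q.2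
  calc ‖∫ y, φ y * g y ∂μ‖ ≤ ‖kernelFun μ K g‖ := (kernelFun μ K g).norm_coe_le_norm ⟨⟩
    _ ≤ ‖K‖ * (μ univ ^ (1 / 2 : ℝ)).toReal * ‖g‖ := norm_kernelFun_le μ K g
    _ ≤ ‖φ‖ * (μ univ ^ (1 / 2 : ℝ)).toReal * ‖g‖ := by gcongr

variable (K : C(X × Y, ℂ))

theorem kernelFun_apply (g : Lp ℂ 2 μ) (x : X) :
    kernelFun μ K g x = ∫ y, K (x, y) * g y ∂μ := rfl

theorem dist_kernelFun_le (g : Lp ℂ 2 μ) (x x' : X) :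
    dist (kernelFun μ K g x) (kernelFun μ K g x') ≤
      dist (K.curry x) (K.curry x') * (μ univ ^ (1 / 2 : ℝ)).toReal * ‖g‖ := by
  have hsub : kernelFun μ K g x - kernelFun μ K g x' =
      ∫ y, (K.curry x - K.curry x') y * g y ∂μ := by
    simp only [kernelFun_apply, ContinuousMap.sub_apply, ContinuousMap.curry_apply, sub_mul]
    exact (integral_sub (integrable_kernel_mul μ K g x) (integrable_kernel_mul μ K g x')).symm
  rw [dist_eq_norm, dist_eq_norm, hsub]
  exact norm_integral_continuousMap_mul_le μ _ g

theorem equicontinuous_kernelFun :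
    Equicontinuous fun g : Metric.closedBall (0 : Lp ℂ 2 μ) 1 => ⇑(kernelFun μ K g) := by
  set c := (μ univ ^ (1 / 2 : ℝ)).toReal
  intro x₀
  refine Metric.equicontinuousAt_of_continuity_modulus
    (fun x => dist (K.curry x₀) (K.curry x) * c) ?_ _ ?_
  · have : Continuous fun x => dist (K.curry x₀) (K.curry x) * c := by fun_prop
    simpa using this.tendsto x₀
  · refine Filter.Eventually.of_forall fun x g => (dist_kernelFun_le μ K g x₀ x).trans ?_
    exact mul_le_of_le_one_right (by positivity) (mem_closedBall_zero_iff.1 g.2)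

theorem isCompact_closure_kernelFun_image_closedBall :
    IsCompact (closure (kernelFun μ K '' Metric.closedBall 0 1)) := by
  refine isCompact_closure_of_isBounded_of_equicontinuous
    (isBounded_iff_forall_norm_le.2 ⟨‖K‖ * (μ univ ^ (1 / 2 : ℝ)).toReal, ?_⟩) ?_
  · rintro _ ⟨g, hg, rfl⟩
    exact (norm_kernelFun_le μ K g).trans
      (mul_le_of_le_one_right (by positivity) (mem_closedBall_zero_iff.1 hg))
  · intro x₀ V hV
    filter_upwards [equicontinuous_kernelFun μ K x₀ V hV] with x hx
    rintro ⟨_, g, hg, rfl⟩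
    exact hx ⟨g, hg⟩

theorem kernelFun_sum {ι : Type*} (s : Finset ι) (k : ι → C(X × Y, ℂ)) (g : Lp ℂ 2 μ) :
    kernelFun μ (∑ i ∈ s, k i) g = ∑ i ∈ s, kernelFun μ (k i) g := by
  ext x
  simp only [kernelFun_apply, ContinuousMap.sum_apply, Finset.sum_mul]
  exact integral_finsetSum _ fun i _ => integrable_kernel_mul μ (k i) g x

/-- The rank-one kernel `(x, y) ↦ f(x) conj(h(y))`. -/
def separableKernel (f : C(X, ℂ)) (h : C(Y, ℂ)) : C(X × Y, ℂ) :=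
  f.comp ⟨Prod.fst, continuous_fst⟩ * (star h).comp ⟨Prod.snd, continuous_snd⟩

/-- The adjoint kernel `(y, x) ↦ conj K(x, y)`, whose operator is the adjoint of that of `K`. -/
def conjKernel : C(Y × X, ℂ) := (star K).comp ⟨Prod.swap, continuous_swap⟩

variable [MeasurableSpace X] [BorelSpace X] (lam : Measure X) [IsFiniteMeasure lam]

theorem kernelOp_apply (g : Lp ℂ 2 μ) :
    kernelOp lam μ K g = ContinuousMap.toLp 2 lam ℂ (kernelFun μ K g) := rfl

theorem coeFn_kernelOp (g : Lp ℂ 2 μ) : kernelOp lam μ K g =ᵐ[lam] kernelFun μ K g :=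
  ContinuousMap.coeFn_toLp (p := 2) (𝕜 := ℂ) lam (kernelFun μ K g)

theorem isCompactOperator_kernelOp : IsCompactOperator (kernelOp lam μ K) := by
  refine (isCompactOperator_iff_image_closedBall_subset_compact
    (kernelOp lam μ K : Lp ℂ 2 μ →ₗ[ℂ] Lp ℂ 2 lam) one_pos).2
    ⟨_, (isCompact_closure_kernelFun_image_closedBall μ K).image
      (ContinuousMap.toLp 2 lam ℂ).continuous, ?_⟩
  rintro _ ⟨g, hg, rfl⟩
  exact mem_image_of_mem _ (subset_closure (mem_image_of_mem _ hg))

theorem adjoint_kernelOp :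
    adjoint (kernelOp lam μ K) = kernelOp μ lam (conjKernel K) := by
  refine (eq_adjoint_iff _ _).2 (fun f g => ?_) |>.symm
  have hint : Integrable (fun q : X × Y => K q * (starRingEnd ℂ (f q.1) * g q.2)) (lam.prod μ) :=
    integrable_continuousMap_mul K
      ((Complex.conjCLE.toContinuousLinearMap.integrable_comp (integrable_coeFn_L2 f)).mul_prod
        (integrable_coeFn_L2 g))
  calc inner ℂ (kernelOp μ lam (conjKernel K) f) g
      = ∫ y, ∫ x, K (x, y) * (starRingEnd ℂ (f x) * g y) ∂lam ∂μ := by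
        rw [L2.inner_def]
        refine integral_congr_ae ?_
        filter_upwards [coeFn_kernelOp lam (conjKernel K) μ f] with y hy
        rw [hy, RCLike.inner_apply, kernelFun_apply, ← integral_conj, ← integral_const_mul]
        refine integral_congr_ae (Filter.Eventually.of_forall fun x => ?_)
        simp only [conjKernel, ContinuousMap.comp_apply, ContinuousMap.coe_mk, Prod.swap_prod_mk,
          ContinuousMap.star_apply, RCLike.star_def, map_mul, Complex.conj_conj]
        ring
    _ = ∫ x, ∫ y, K (x, y) * (starRingEnd ℂ (f x) * g y) ∂μ ∂lam :=
        (integral_integral_swap hint).symm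
    _ = inner ℂ f (kernelOp lam μ K g) := by
        rw [L2.inner_def]
        refine integral_congr_ae ?_
        filter_upwards [coeFn_kernelOp μ K lam g] with x hx
        rw [hx, RCLike.inner_apply, kernelFun_apply, ← integral_mul_const]
        exact integral_congr_ae (Filter.Eventually.of_forall fun y => by ring)

theorem kernelOp_sum {ι : Type*} (s : Finset ι) (k : ι → C(X × Y, ℂ)) :
    kernelOp lam μ (∑ i ∈ s, k i) = ∑ i ∈ s, kernelOp lam μ (k i) := by
  ext1 g
  simp only [sum_apply, kernelOp_apply, kernelFun_sum, map_sum]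

theorem kernelOp_separableKernel (f : C(X, ℂ)) (h : C(Y, ℂ)) :
    kernelOp lam μ (separableKernel f h) =
      InnerProductSpace.rankOne ℂ (ContinuousMap.toLp 2 lam ℂ f) (ContinuousMap.toLp 2 μ ℂ h) := by
  ext1 g
  have hinner : inner ℂ (ContinuousMap.toLp 2 μ ℂ h) g = ∫ y, starRingEnd ℂ (h y) * g y ∂μ := by
    rw [L2.inner_def]
    refine integral_congr_ae ?_
    filter_upwards [ContinuousMap.coeFn_toLp (p := 2) (𝕜 := ℂ) μ h] with y hy
    rw [hy, RCLike.inner_apply, mul_comm]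
  rw [InnerProductSpace.rankOne_apply, kernelOp_apply, ← map_smul, hinner]
  congr 1
  ext x
  rw [kernelFun_apply, ContinuousMap.smul_apply, smul_eq_mul, ← integral_mul_const]
  refine integral_congr_ae (Filter.Eventually.of_forall fun y => ?_)
  simp only [separableKernel, ContinuousMap.mul_apply, ContinuousMap.comp_apply,
    ContinuousMap.coe_mk, ContinuousMap.star_apply, RCLike.star_def]
  ring

theorem exists_kernelOp_eq_comp_starProjection (W : Submodule ℂ (Lp ℂ 2 μ))
    [FiniteDimensional ℂ W]
    (hW : W ≤ LinearMap.range (ContinuousMap.toLp 2 μ ℂ : C(Y, ℂ) →L[ℂ] Lp ℂ 2 μ).toLinearMap) :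
    ∃ Kn : C(X × Y, ℂ), kernelOp lam μ Kn = kernelOp lam μ K ∘L W.starProjection := by
  let b := stdOrthonormalBasis ℂ W
  choose f hf using fun i => hW (b i).2
  refine ⟨∑ i, separableKernel (kernelFun μ K (b i)) (f i), ?_⟩
  rw [kernelOp_sum, b.starProjection_eq_sum_rankOne, comp_finsetSum]
  refine Finset.sum_congr rfl fun i _ => ?_
  rw [kernelOp_separableKernel, InnerProductSpace.comp_rankOne, kernelOp_apply]
  exact congrArg _ (hf i)

theorem range_kernelOp_le_range_toLp :
    LinearMap.range (kernelOp lam μ K).toLinearMap ≤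
      LinearMap.range (ContinuousMap.toLp 2 lam ℂ : C(X, ℂ) →L[ℂ] Lp ℂ 2 lam).toLinearMap := by
  rintro _ ⟨g, rfl⟩
  exact ⟨kernelFun μ K g, rfl⟩

end KernelOperators

section RankApproximation

open ContinuousLinearMap

theorem rank_comp_starProjection_le {𝕜 H : Type*} [RCLike 𝕜] [NormedAddCommGroup H]
    [InnerProductSpace 𝕜 H] {V : Type*} [TopologicalSpace V] [AddCommGroup V] [Module 𝕜 V]
    (T : H →L[𝕜] V) (W : Submodule 𝕜 H) [W.HasOrthogonalProjection] {n : ℕ}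
    (hW : Module.rank 𝕜 W ≤ n) : LinearMap.rank (T ∘L W.starProjection).toLinearMap ≤ n := by
  have hle : LinearMap.range (T ∘L W.starProjection).toLinearMap ≤ W.map T.toLinearMap := by
    rintro _ ⟨g, rfl⟩
    exact ⟨W.starProjection g, W.starProjection_apply_mem g, rfl⟩
  have hmap := (lift_rank_map_le T.toLinearMap W).trans (Cardinal.lift_le_nat_iff.2 hW)
  exact (Submodule.rank_mono hle).trans (Cardinal.lift_le_nat_iff.1 hmap)

theorem norm_sub_comp_starProjection_singularSpace_le {𝕜 H₁ H₂ : Type*} [RCLike 𝕜]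
    [NormedAddCommGroup H₁] [InnerProductSpace 𝕜 H₁] [CompleteSpace H₁]
    [NormedAddCommGroup H₂] [InnerProductSpace 𝕜 H₂] [CompleteSpace H₂]
    {T : H₁ →L[𝕜] H₂} (hT : IsCompactOperator T) {c : ℝ} (hc : 0 ≤ c)
    [(singularSpace T (Ioi (c ^ 2))).HasOrthogonalProjection] :
    ‖T - T ∘L (singularSpace T (Ioi (c ^ 2))).starProjection‖ ≤ c := by
  set W := singularSpace T (Ioi (c ^ 2))
  refine opNorm_le_bound _ hc fun g => ?_
  calc ‖(T - T ∘L W.starProjection) g‖ = ‖T (g - W.starProjection g)‖ := by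
        rw [sub_apply, comp_apply, map_sub]
    _ ≤ c * ‖g - W.starProjection g‖ :=
        norm_le_of_mem_orthogonal_singularSpace T hT hc (W.sub_starProjection_mem_orthogonal g)
    _ ≤ c * ‖g‖ := by
        gcongr
        simpa only [Submodule.starProjection_orthogonal_val] using Wᗮ.norm_starProjection_apply_le g

theorem exists_kernelOp_rank_le {X Y : Type*} [MetricSpace X] [CompactSpace X] [MeasurableSpace X]
    [BorelSpace X] [MetricSpace Y] [CompactSpace Y] [MeasurableSpace Y] [BorelSpace Y]
    (lam : Measure X) [IsFiniteMeasure lam] (μ : Measure Y) [IsFiniteMeasure μ] (K : C(X × Y, ℂ))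
    {c : ℝ} (hc : 0 ≤ c) {n : ℕ}
    (h : ∀ c' > c, ∃ l : Lp ℂ 2 μ →ₗ[ℂ] (Fin n → ℂ),
      ∀ g, l g = 0 → ‖kernelOp lam μ K g‖ ≤ c' * ‖g‖) :
    ∃ Kn : C(X × Y, ℂ), LinearMap.rank (kernelOp lam μ Kn).toLinearMap ≤ n ∧
      ‖kernelOp lam μ K - kernelOp lam μ Kn‖ ≤ c := by
  set W := singularSpace (kernelOp lam μ K) (Ioi (c ^ 2))
  have hrank : Module.rank ℂ W ≤ n := rank_singularSpace_Ioi_le _ hc h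
  have : FiniteDimensional ℂ W :=
    Module.rank_lt_aleph0_iff.1 (hrank.trans_lt Cardinal.natCast_lt_aleph0)
  have hrange := singularSpace_le_range_adjoint (kernelOp lam μ K) (s := Ioi (c ^ 2))
    (sq_nonneg c).not_gt
  rw [adjoint_kernelOp] at hrange
  obtain ⟨Kn, hKn⟩ := exists_kernelOp_eq_comp_starProjection μ K lam W
    (hrange.trans (range_kernelOp_le_range_toLp lam (conjKernel K) μ))
  exact ⟨Kn, hKn ▸ rank_comp_starProjection_le _ W hrank,
    hKn ▸ norm_sub_comp_starProjection_singularSpace_le (isCompactOperator_kernelOp μ K lam) hc⟩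

end RankApproximation

section DirectedCycles

variable {V : Type*}

/-- A finite set of directed edges is balanced if every vertex has as many incoming as outgoing
edges; equivalently, every potential `f` has total increment zero along the edges. -/
def BalancedEdges (S : Finset (V × V)) : Prop := ∀ f : V → ℤ, ∑ e ∈ S, (f e.2 - f e.1) = 0

theorem BalancedEdges.exists_next {S : Finset (V × V)} (hS : BalancedEdges S) {u v : V}
    (h : (u, v) ∈ S) : ∃ w, (v, w) ∈ S := by
  classical
  by_contra! hno
  let f : V → ℤ := Pi.single v 1
  have hincr : ∀ e ∈ S, f e.2 - f e.1 = f e.2 := fun e he => by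
    have hv : e.1 ≠ v := fun hv => hno e.2 (hv ▸ he)
    simp only [f, Pi.single_eq_of_ne hv, sub_zero]
  have hnonneg : 0 ≤ f := Pi.single_nonneg.2 zero_le_one
  have hsum : ∑ e ∈ S, f e.2 = 0 := by rw [← Finset.sum_congr rfl hincr, hS]
  simpa [f] using (Finset.sum_eq_zero_iff_of_nonneg fun e _ => hnonneg e.2).1 hsum (u, v) h

/-- `c 0, …, c k` is a simple closed walk: `c k = c 0`, with no other repetition. -/
structure IsSimpleCycle (k : ℕ) (c : ℕ → V) : Prop where
  pos : 0 < k
  closed : c k = c 0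
  injOn : InjOn c (Iio k)

theorem exists_isSimpleCycle_iterate [Finite V] [Nonempty V] (s : V → V) :
    ∃ (v : V) (k : ℕ), IsSimpleCycle k fun i => s^[i] v := by
  obtain ⟨v₀⟩ := ‹Nonempty V›
  obtain ⟨i, j, hij, heq⟩ := Finite.exists_ne_map_eq_of_infinite fun i : ℕ => s^[i] v₀
  wlog hlt : i < j generalizing i j
  · exact this j i hij.symm heq.symm (by omega)
  have hperiodic : Function.IsPeriodicPt s (j - i) (s^[i] v₀) := by
    rw [Function.IsPeriodicPt, Function.IsFixedPt, ← Function.iterate_add_apply,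
      Nat.sub_add_cancel hlt.le]
    exact heq.symm
  exact ⟨s^[i] v₀, Function.minimalPeriod s (s^[i] v₀),
    hperiodic.minimalPeriod_pos (by omega), Function.iterate_minimalPeriod,
    Function.iterate_injOn_Iio_minimalPeriod⟩

variable [DecidableEq V]

/-- The edges of the walk `c 0, …, c k`. -/
def walkEdges (k : ℕ) (c : ℕ → V) : Finset (V × V) :=
  (Finset.range k).image fun i => (c i, c (i + 1))

theorem IsSimpleCycle.sum_walkEdges {M : Type*} [AddCommMonoid M] {k : ℕ} {c : ℕ → V}
    (hc : IsSimpleCycle k c) (J : V × V → M) :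
    ∑ e ∈ walkEdges k c, J e = ∑ i ∈ Finset.range k, J (c i, c (i + 1)) := by
  refine Finset.sum_image fun i hi j hj hij => ?_
  exact hc.injOn (by simpa using hi) (by simpa using hj) (congrArg Prod.fst hij)

theorem IsSimpleCycle.balancedEdges_walkEdges {k : ℕ} {c : ℕ → V} (hc : IsSimpleCycle k c) :
    BalancedEdges (walkEdges k c) := fun f => by
  rw [hc.sum_walkEdges, Finset.sum_range_sub fun i => f (c i), hc.closed, sub_self]

theorem BalancedEdges.sdiff {S T : Finset (V × V)} (hS : BalancedEdges S) (hT : BalancedEdges T)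
    (h : T ⊆ S) : BalancedEdges (S \ T) := fun f => by
  rw [Finset.sum_sdiff_eq_sub h, hS f, hT f, sub_zero]

theorem BalancedEdges.exists_isSimpleCycle {S : Finset (V × V)} (hS : BalancedEdges S)
    (hne : S.Nonempty) : ∃ k c, IsSimpleCycle k c ∧ walkEdges k c ⊆ S := by
  let heads := S.image Prod.snd
  have hnext (v : heads) : ∃ w : heads, ((v : V), (w : V)) ∈ S := by
    obtain ⟨v, hv⟩ := v
    obtain ⟨⟨u, v⟩, he, rfl⟩ := Finset.mem_image.1 hv
    obtain ⟨w, hw⟩ := hS.exists_next he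
    exact ⟨⟨w, Finset.mem_image_of_mem Prod.snd hw⟩, hw⟩
  choose s hs using hnext
  have : Nonempty heads := (hne.image _).coe_sort
  obtain ⟨v, k, hk⟩ := exists_isSimpleCycle_iterate s
  refine ⟨k, fun i => s^[i] v, ⟨hk.pos, congrArg Subtype.val hk.closed,
    Subtype.val_injective.comp_injOn hk.injOn⟩, ?_⟩
  rintro _ he
  obtain ⟨i, -, rfl⟩ := Finset.mem_image.1 he
  simpa only [Function.iterate_succ_apply'] using hs (s^[i] v)

theorem BalancedEdges.induction {motive : Finset (V × V) → Prop} (empty : motive ∅)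
    (cycle : ∀ S k c, IsSimpleCycle k c → walkEdges k c ⊆ S → motive (S \ walkEdges k c) →
      motive S)
    {S : Finset (V × V)} (hS : BalancedEdges S) : motive S := by
  induction S using Finset.strongInduction with
  | H S ih =>
    rcases S.eq_empty_or_nonempty with rfl | hne
    · exact empty
    obtain ⟨k, c, hc, hsub⟩ := hS.exists_isSimpleCycle hne
    have hedges : (walkEdges k c).Nonempty := (Finset.nonempty_range_iff.2 hc.pos.ne').image _
    exact cycle S k c hc hsub (ih _ (Finset.sdiff_ssubset hsub hedges)
      (hS.sdiff hc.balancedEdges_walkEdges hsub))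

/-- The edges of `S` whose reversal does not belong to `S`. -/
def reducedEdges (S : Finset (V × V)) : Finset (V × V) := {e ∈ S | e.swap ∉ S}

theorem sum_reducedEdges {M : Type*} [AddCommGroup M] {S : Finset (V × V)}
    (hloop : ∀ e ∈ S, e.1 ≠ e.2) {J : V × V → M} (hJ : ∀ e, J e.swap = -J e) :
    ∑ e ∈ reducedEdges S, J e = ∑ e ∈ S, J e := by
  rw [← Finset.sum_filter_add_sum_filter_not S (fun e => e.swap ∉ S), reducedEdges,
    left_eq_add]
  refine Finset.sum_involution (fun e _ => e.swap) (fun e _ => ?_) (fun e he _ h => ?_)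
    (fun e he => ?_) fun e _ => Prod.swap_swap e
  · rw [hJ, add_neg_cancel]
  · exact hloop e (Finset.mem_filter.1 he).1 (congrArg Prod.fst h).symm
  · simpa [and_comm] using he

theorem BalancedEdges.reducedEdges {S : Finset (V × V)} (hS : BalancedEdges S)
    (hloop : ∀ e ∈ S, e.1 ≠ e.2) : BalancedEdges (reducedEdges S) := fun f => by
  rw [sum_reducedEdges hloop fun _ => (neg_sub _ _).symm, hS f]

end DirectedCycles

section Polyline

/-- The integral of `f` along the segment from `a` to `b`. -/
def edgeIntegral (f : ℂ → ℂ) (a b : ℂ) : ℂ := ∫ s in (0 : ℝ)..1, f (a + s * (b - a)) * (b - a)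

theorem edgeIntegral_swap (f : ℂ → ℂ) (a b : ℂ) : edgeIntegral f b a = -edgeIntegral f a b := by
  have hrefl := intervalIntegral.integral_comp_sub_left (a := 0) (b := 1)
    (fun s : ℝ => f (a + s * (b - a)) * (b - a)) 1
  rw [sub_self, sub_zero] at hrefl
  rw [edgeIntegral, edgeIntegral, ← hrefl, ← intervalIntegral.integral_neg]
  congr 1 with s
  push_cast
  ring_nf

theorem add_mul_sub_mem_segment {a b : ℂ} {s : ℝ} (hs : s ∈ Icc (0 : ℝ) 1) :
    a + s * (b - a) ∈ segment ℝ a b := by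
  rw [segment_eq_image']
  exact ⟨s, hs, by simp only [Complex.real_smul]⟩

theorem continuousOn_comp_segment {f : ℂ → ℂ} {a b : ℂ} (hf : ContinuousOn f (segment ℝ a b)) :
    ContinuousOn (fun s : ℝ => f (a + s * (b - a))) (Icc 0 1) :=
  hf.comp (by fun_prop) fun _ => add_mul_sub_mem_segment

/-- The polygonal path through `P 0, …, P k`, parametrized on `[0, 1]` so that the edge from `P i`
to `P (i + 1)` is traversed during `[i / k, (i + 1) / k]`. -/
def polyline (P : ℕ → ℂ) (k : ℕ) (t : ℝ) : ℂ :=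
  P 0 + ∑ i ∈ Finset.range k, (max 0 (min 1 (k * t - i)) : ℝ) • (P (i + 1) - P i)

variable (P : ℕ → ℂ) {k i : ℕ} {t : ℝ}

theorem polyline_eq (hi : i < k) (h0 : i ≤ k * t) (h1 : k * t ≤ i + 1) :
    polyline P k t = P i + ((k * t - i : ℝ) : ℂ) * (P (i + 1) - P i) := by
  have hpast : ∀ j ∈ Finset.range i,
      (max 0 (min 1 (k * t - j)) : ℝ) • (P (j + 1) - P j) = P (j + 1) - P j := fun j hj => by
    have hj : (j : ℝ) + 1 ≤ i := by exact_mod_cast Finset.mem_range.1 hj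
    rw [min_eq_left (by linarith), max_eq_right zero_le_one, one_smul]
  have hfuture : ∀ j ∈ Finset.range k, j ∉ Finset.range (i + 1) →
      (max 0 (min 1 (k * t - j)) : ℝ) • (P (j + 1) - P j) = 0 := fun j _ hj => by
    have hj : (i : ℝ) + 1 ≤ j := by exact_mod_cast Nat.succ_le_of_lt (by simpa using hj)
    rw [min_eq_right (by linarith), max_eq_left (by linarith), zero_smul]
  rw [polyline, ← Finset.sum_subset (Finset.range_mono hi) hfuture, Finset.sum_range_succ,
    Finset.sum_congr rfl hpast, Finset.sum_range_sub, min_eq_right (by linarith),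
    max_eq_right (by linarith), Complex.real_smul]
  ring

variable (k) in
theorem exists_lipschitzWith_polyline : ∃ C, LipschitzWith C (polyline P k) := by
  have hpartial (m : ℕ) : ∃ C, LipschitzWith C fun t : ℝ => P 0 + ∑ i ∈ Finset.range m,
      (max 0 (min 1 (k * t - i)) : ℝ) • (P (i + 1) - P i) := by
    induction m with
    | zero => exact ⟨0, by simp⟩
    | succ m ih =>
      obtain ⟨C, hC⟩ := ih
      have htime : LipschitzWith ‖(k : ℝ)‖₊ fun t : ℝ => (k : ℝ) * t - m :=
        LipschitzWith.of_dist_le_mul fun x y => by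
          rw [dist_sub_right, dist_eq_norm, dist_eq_norm, ← mul_sub, norm_mul, coe_nnnorm]
      have hedge := (ContinuousLinearMap.toSpanSingleton ℝ (P (m + 1) - P m)).lipschitz.comp
        ((htime.const_min 1).const_max 0)
      simp only [Finset.sum_range_succ, ← add_assoc]
      exact ⟨_, hC.add hedge⟩
  exact hpartial k

theorem exists_floor_lt (hk : 0 < k) (ht : t ∈ Ico (0 : ℝ) 1) :
    ∃ i < k, (i : ℝ) ≤ k * t ∧ k * t < i + 1 := by
  have hk' : (0 : ℝ) < k := Nat.cast_pos.2 hk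
  have h0 : 0 ≤ k * t := mul_nonneg hk'.le ht.1
  exact ⟨⌊k * t⌋₊, (Nat.floor_lt h0).2 (mul_lt_of_lt_one_right hk' ht.2), Nat.floor_le h0,
    Nat.lt_floor_add_one _⟩

theorem polyline_one (hk : 0 < k) : polyline P k 1 = P k := by
  obtain ⟨m, rfl⟩ := Nat.exists_eq_succ_of_ne_zero hk.ne'
  rw [polyline_eq P (Nat.lt_succ_self m) (by push_cast; linarith) (by push_cast; linarith)]
  push_cast
  ring

theorem polyline_zero (hk : 0 < k) : polyline P k 0 = P 0 := by
  rw [polyline_eq P hk (by simp) (by simp)]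
  simp

theorem polyline_mem_segment (hk : 0 < k) (ht : t ∈ Icc (0 : ℝ) 1) :
    ∃ i < k, polyline P k t ∈ segment ℝ (P i) (P (i + 1)) := by
  rcases ht.2.lt_or_eq with h | rfl
  · obtain ⟨i, hi, h0, h1⟩ := exists_floor_lt hk ⟨ht.1, h⟩
    refine ⟨i, hi, ?_⟩
    rw [polyline_eq P hi h0 h1.le]
    exact add_mul_sub_mem_segment ⟨by linarith, by linarith⟩
  · refine ⟨k - 1, by omega, ?_⟩
    rw [polyline_one P hk, Nat.sub_add_cancel hk]
    exact right_mem_segment _ _ _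

/-- A closed polygonal path whose half-open edges are pairwise disjoint, as a Jordan curve. -/
def polylineCurve (k : ℕ) (hk : 0 < k) (hcl : P k = P 0)
    (hinj : ∀ i < k, ∀ j < k, ∀ s ∈ Ico (0 : ℝ) 1, ∀ t ∈ Ico (0 : ℝ) 1,
      P i + s * (P (i + 1) - P i) = P j + t * (P (j + 1) - P j) → i = j ∧ s = t) : JordanCurve where
  toFun := polyline P k
  lipschitz := (exists_lipschitzWith_polyline P k).imp fun _ h => h.lipschitzOnWith
  closed := by rw [polyline_zero P hk, polyline_one P hk, hcl]
  injOn := by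
    intro s hs t ht hst
    obtain ⟨i, hi, hi0, hi1⟩ := exists_floor_lt hk hs
    obtain ⟨j, hj, hj0, hj1⟩ := exists_floor_lt hk ht
    rw [polyline_eq P hi hi0 hi1.le, polyline_eq P hj hj0 hj1.le] at hst
    obtain ⟨rfl, h⟩ := hinj i hi j hj _ ⟨by linarith, by linarith⟩ _
      ⟨by linarith, by linarith⟩ hst
    exact mul_left_cancel₀ (Nat.cast_ne_zero.2 hk.ne') (sub_left_inj.1 h)

theorem mul_mem_Icc_of_mem_Icc_div (hi : i < k) (ht : t ∈ Icc (i / k : ℝ) ((i + 1) / k)) :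
    k * t - i ∈ Icc (0 : ℝ) 1 := by
  have hk : (0 : ℝ) < k := Nat.cast_pos.2 (by omega)
  have h0 := (div_le_iff₀' hk).1 ht.1
  have h1 := (le_div_iff₀' hk).1 ht.2
  exact ⟨by linarith, by linarith⟩

theorem polyline_eq_of_mem_Icc_div (hi : i < k) (ht : t ∈ Icc (i / k : ℝ) ((i + 1) / k)) :
    polyline P k t = P i + ((k * t - i : ℝ) : ℂ) * (P (i + 1) - P i) := by
  obtain ⟨h0, h1⟩ := mul_mem_Icc_of_mem_Icc_div hi ht
  exact polyline_eq P hi (by linarith) (by linarith)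

theorem hasDerivAt_polyline (hi : i < k) (ht : t ∈ Ioo (i / k : ℝ) ((i + 1) / k)) :
    HasDerivAt (polyline P k) (k * (P (i + 1) - P i)) t := by
  have htime : HasDerivAt (fun u : ℝ => ((k * u - i : ℝ) : ℂ)) ((k : ℝ) : ℂ) t :=
    HasDerivAt.ofReal_comp (by simpa using ((hasDerivAt_id' t).const_mul (k : ℝ)).sub_const (i : ℝ))
  refine ((htime.mul_const (P (i + 1) - P i)).const_add (P i)).congr_of_eventuallyEq ?_
  filter_upwards [isOpen_Ioo.mem_nhds ht] with u hu
    using polyline_eq_of_mem_Icc_div P hi (Ioo_subset_Icc_self hu)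

theorem polyline_integrand_eq (f : ℂ → ℂ) (hi : i < k) (ht : t ∈ Ioo (i / k : ℝ) ((i + 1) / k)) :
    f (polyline P k t) * deriv (polyline P k) t =
      k * (f (P i + ((k * t - i : ℝ) : ℂ) * (P (i + 1) - P i)) * (P (i + 1) - P i)) := by
  rw [(hasDerivAt_polyline P hi ht).deriv,
    polyline_eq_of_mem_Icc_div P hi (Ioo_subset_Icc_self ht)]
  ring

theorem intervalIntegrable_polyline {f : ℂ → ℂ} (hi : i < k)
    (hf : ContinuousOn f (segment ℝ (P i) (P (i + 1)))) :
    IntervalIntegrable (fun t => f (polyline P k t) * deriv (polyline P k) t) volume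
      (i / k : ℝ) ((i + 1) / k) := by
  have hle : (i / k : ℝ) ≤ (i + 1) / k := by gcongr; linarith
  have hcont : ContinuousOn (fun t : ℝ => (k : ℂ) *
      (f (P i + ((k * t - i : ℝ) : ℂ) * (P (i + 1) - P i)) * (P (i + 1) - P i)))
      (Icc (i / k : ℝ) ((i + 1) / k)) :=
    continuousOn_const.mul (ContinuousOn.mul ((continuousOn_comp_segment hf).comp (by fun_prop)
      fun _ => mul_mem_Icc_of_mem_Icc_div hi) continuousOn_const)
  rw [← uIcc_of_le hle] at hcont
  refine hcont.intervalIntegrable.congr_uIoo fun t ht => ?_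
  rw [uIoo_of_le hle] at ht
  exact (polyline_integrand_eq P f hi ht).symm

theorem integral_polyline_edge (f : ℂ → ℂ) (hi : i < k) :
    ∫ t in (i / k : ℝ)..(i + 1) / k, f (polyline P k t) * deriv (polyline P k) t =
      edgeIntegral f (P i) (P (i + 1)) := by
  have hk : (k : ℝ) ≠ 0 := Nat.cast_ne_zero.2 (by omega)
  have hle : (i / k : ℝ) ≤ (i + 1) / k := by gcongr; linarith
  rw [intervalIntegral.integral_congr_Ioo_of_le hle fun t => polyline_integrand_eq P f hi,
    intervalIntegral.integral_const_mul, intervalIntegral.integral_comp_mul_sub (fun s : ℝ =>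
      f (P i + s * (P (i + 1) - P i)) * (P (i + 1) - P i)) hk, mul_div_cancel₀ _ hk,
    mul_div_cancel₀ _ hk, sub_self, add_sub_cancel_left, Complex.real_smul, ← mul_assoc,
    Complex.ofReal_inv, Complex.ofReal_natCast, mul_inv_cancel₀ (by exact_mod_cast hk), one_mul,
    edgeIntegral]

theorem integral_polyline (hk : 0 < k) {f : ℂ → ℂ}
    (hf : ∀ i < k, ContinuousOn f (segment ℝ (P i) (P (i + 1)))) :
    ∫ t in (0 : ℝ)..1, f (polyline P k t) * deriv (polyline P k) t =
      ∑ i ∈ Finset.range k, edgeIntegral f (P i) (P (i + 1)) := by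
  have hadj := intervalIntegral.sum_integral_adjacent_intervals (n := k) (μ := volume)
    (f := fun t => f (polyline P k t) * deriv (polyline P k) t) (a := fun i => (i : ℝ) / k)
    fun i hi => by simpa using intervalIntegrable_polyline P hi (hf i hi)
  rw [Nat.cast_zero, zero_div, div_self (Nat.cast_ne_zero.2 hk.ne')] at hadj
  rw [← hadj]
  refine Finset.sum_congr rfl fun i hi => ?_
  rw [Nat.cast_succ, integral_polyline_edge P f (Finset.mem_range.1 hi)]

end Polyline

section Grid

/-- Neighbouring points of the square lattice. -/
def IsGridStep (u v : ℤ × ℤ) : Prop := (v.1 - u.1).natAbs + (v.2 - u.2).natAbs = 1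

/-- The four sides of the lattice square with lower left corner `q`, directed clockwise. -/
def squareEdges (q : ℤ × ℤ) : Finset ((ℤ × ℤ) × (ℤ × ℤ)) :=
  {(q, (q.1, q.2 + 1)), ((q.1, q.2 + 1), (q.1 + 1, q.2 + 1)),
    ((q.1 + 1, q.2 + 1), (q.1 + 1, q.2)), ((q.1 + 1, q.2), q)}

/-- The sides of the squares in `A` that are not shared by two of them, directed so that the
squares of `A` lie to their right. -/
def boundaryEdges (A : Finset (ℤ × ℤ)) : Finset ((ℤ × ℤ) × (ℤ × ℤ)) :=
  reducedEdges (A.biUnion squareEdges)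

variable {q q' : ℤ × ℤ} {e : (ℤ × ℤ) × (ℤ × ℤ)} {A : Finset (ℤ × ℤ)}

theorem mem_squareEdges : e ∈ squareEdges q ↔
    e.1.1 = q.1 ∧ e.1.2 = q.2 ∧ e.2.1 = q.1 ∧ e.2.2 = q.2 + 1 ∨
    e.1.1 = q.1 ∧ e.1.2 = q.2 + 1 ∧ e.2.1 = q.1 + 1 ∧ e.2.2 = q.2 + 1 ∨
    e.1.1 = q.1 + 1 ∧ e.1.2 = q.2 + 1 ∧ e.2.1 = q.1 + 1 ∧ e.2.2 = q.2 ∨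
    e.1.1 = q.1 + 1 ∧ e.1.2 = q.2 ∧ e.2.1 = q.1 ∧ e.2.2 = q.2 := by
  simp only [squareEdges, Finset.mem_insert, Finset.mem_singleton, Prod.ext_iff, and_assoc]

theorem eq_of_mem_squareEdges (he : e ∈ squareEdges q) (he' : e ∈ squareEdges q') : q = q' := by
  rw [mem_squareEdges] at he he'
  rw [Prod.ext_iff]
  omega

theorem isGridStep_of_mem_squareEdges (he : e ∈ squareEdges q) : IsGridStep e.1 e.2 := by
  rw [mem_squareEdges] at he
  rw [IsGridStep]
  omega

theorem IsGridStep.ne {u v : ℤ × ℤ} (h : IsGridStep u v) : u ≠ v := by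
  rintro rfl
  simp [IsGridStep] at h

theorem exists_swap_mem_squareEdges (he : e ∈ squareEdges q) : ∃ q', e.swap ∈ squareEdges q' := by
  simp only [mem_squareEdges, Prod.fst_swap, Prod.snd_swap] at he ⊢
  rcases he with h | h | h | h
  · exact ⟨(q.1 - 1, q.2), by omega⟩
  · exact ⟨(q.1, q.2 + 1), by omega⟩
  · exact ⟨(q.1 + 1, q.2), by omega⟩
  · exact ⟨(q.1, q.2 - 1), by omega⟩

theorem sum_squareEdges {M : Type*} [AddCommMonoid M] (q : ℤ × ℤ) (J : (ℤ × ℤ) × (ℤ × ℤ) → M) :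
    ∑ e ∈ squareEdges q, J e =
      J (q, (q.1, q.2 + 1)) + (J ((q.1, q.2 + 1), (q.1 + 1, q.2 + 1)) +
        (J ((q.1 + 1, q.2 + 1), (q.1 + 1, q.2)) + J ((q.1 + 1, q.2), q))) := by
  rw [squareEdges, Finset.sum_insert, Finset.sum_insert, Finset.sum_insert,
    Finset.sum_singleton] <;> simp [Prod.ext_iff]

theorem sum_biUnion_squareEdges {M : Type*} [AddCommMonoid M] (J : (ℤ × ℤ) × (ℤ × ℤ) → M) :
    ∑ e ∈ A.biUnion squareEdges, J e = ∑ q ∈ A, ∑ e ∈ squareEdges q, J e :=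
  Finset.sum_biUnion fun _ _ _ _ h =>
    Finset.disjoint_left.2 fun _ he he' => h (eq_of_mem_squareEdges he he')

theorem isGridStep_of_mem_biUnion_squareEdges (he : e ∈ A.biUnion squareEdges) :
    IsGridStep e.1 e.2 := by
  obtain ⟨q, -, hq⟩ := Finset.mem_biUnion.1 he
  exact isGridStep_of_mem_squareEdges hq

theorem isGridStep_of_mem_boundaryEdges (he : e ∈ boundaryEdges A) : IsGridStep e.1 e.2 :=
  isGridStep_of_mem_biUnion_squareEdges (Finset.mem_filter.1 he).1

theorem swap_notMem_boundaryEdges (he : e ∈ boundaryEdges A) : e.swap ∉ boundaryEdges A :=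
  fun h => (Finset.mem_filter.1 he).2 (Finset.mem_filter.1 h).1

theorem exists_mem_squareEdges_of_mem_boundaryEdges (he : e ∈ boundaryEdges A) :
    ∃ q ∈ A, ∃ q' ∉ A, e ∈ squareEdges q ∧ e.swap ∈ squareEdges q' := by
  obtain ⟨hmem, hswap⟩ := Finset.mem_filter.1 he
  obtain ⟨q, hqA, hq⟩ := Finset.mem_biUnion.1 hmem
  obtain ⟨q', hq'⟩ := exists_swap_mem_squareEdges hq
  exact ⟨q, hqA, q', fun h => hswap (Finset.mem_biUnion.2 ⟨q', h, hq'⟩), hq, hq'⟩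

theorem sum_boundaryEdges {M : Type*} [AddCommGroup M] {J : (ℤ × ℤ) × (ℤ × ℤ) → M}
    (hJ : ∀ e, J e.swap = -J e) :
    ∑ e ∈ boundaryEdges A, J e = ∑ q ∈ A, ∑ e ∈ squareEdges q, J e := by
  rw [boundaryEdges, sum_reducedEdges
    (fun e he => (isGridStep_of_mem_biUnion_squareEdges he).ne) hJ, sum_biUnion_squareEdges]

variable (A) in
theorem balancedEdges_boundaryEdges : BalancedEdges (boundaryEdges A) := by
  refine BalancedEdges.reducedEdges (fun f => ?_)
    fun e he => (isGridStep_of_mem_biUnion_squareEdges he).ne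
  rw [sum_biUnion_squareEdges]
  refine Finset.sum_eq_zero fun q _ => ?_
  rw [sum_squareEdges]
  ring

/-- The point of the square lattice of mesh `δ` with integer coordinates `v`. -/
def gridPoint (δ : ℝ) (v : ℤ × ℤ) : ℂ := ⟨δ * v.1, δ * v.2⟩

/-- The closed square of mesh `δ` with lower left corner at `q`. -/
def gridSquare (δ : ℝ) (q : ℤ × ℤ) : Set ℂ :=
  Icc (δ * q.1) (δ * (q.1 + 1)) ×ℂ Icc (δ * q.2) (δ * (q.2 + 1))

/-- The interior of `gridSquare δ q`. -/
def openGridSquare (δ : ℝ) (q : ℤ × ℤ) : Set ℂ :=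
  Ioo (δ * q.1) (δ * (q.1 + 1)) ×ℂ Ioo (δ * q.2) (δ * (q.2 + 1))

theorem floor_add_mul_sub {m m' : ℤ} {s : ℝ} (hm : (m' - m).natAbs ≤ 1) (hs : s ∈ Ioo (0 : ℝ) 1) :
    ⌊m + s * ((m' : ℝ) - m)⌋ = min m m' := by
  obtain rfl | rfl | rfl : m' = m ∨ m' = m + 1 ∨ m' = m - 1 := by omega
  · simp
  · rw [min_eq_left (by omega), Int.floor_eq_iff]
    push_cast
    constructor <;> linarith [hs.1, hs.2]
  · rw [min_eq_right (by omega), Int.floor_eq_iff]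
    push_cast
    constructor <;> linarith [hs.1, hs.2]

theorem ceil_add_mul_sub {m m' : ℤ} {s : ℝ} (hm : (m' - m).natAbs ≤ 1) (hs : s ∈ Ioo (0 : ℝ) 1) :
    ⌈m + s * ((m' : ℝ) - m)⌉ = max m m' := by
  have hfloor := floor_add_mul_sub (m := -m) (m' := -m') (by omega) hs
  have hneg : ((-m : ℤ) : ℝ) + s * ((-m' : ℤ) - (-m : ℤ)) = -(m + s * (m' - m)) := by
    push_cast
    ring
  rw [hneg, Int.floor_neg] at hfloor
  omega

theorem eq_zero_of_add_mul_sub_eq {a b b' : ℤ × ℤ} {t : ℝ} (hb : IsGridStep b b')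
    (ht : t ∈ Ico (0 : ℝ) 1) (hfst : (a.1 : ℝ) = b.1 + t * (b'.1 - b.1))
    (hsnd : (a.2 : ℝ) = b.2 + t * (b'.2 - b.2)) : t = 0 := by
  by_contra h0
  have ht' : t ∈ Ioo (0 : ℝ) 1 := ⟨ht.1.lt_of_ne' h0, ht.2⟩
  rw [IsGridStep] at hb
  have hmin1 := floor_add_mul_sub (m := b.1) (m' := b'.1) (by omega) ht'
  have hmax1 := ceil_add_mul_sub (m := b.1) (m' := b'.1) (by omega) ht'
  have hmin2 := floor_add_mul_sub (m := b.2) (m' := b'.2) (by omega) ht'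
  have hmax2 := ceil_add_mul_sub (m := b.2) (m' := b'.2) (by omega) ht'
  rw [← hfst, Int.floor_intCast] at hmin1
  rw [← hfst, Int.ceil_intCast] at hmax1
  rw [← hsnd, Int.floor_intCast] at hmin2
  rw [← hsnd, Int.ceil_intCast] at hmax2
  omega

-- Rounding the coordinates of an inner point of an edge down and up recovers the two endpoints.
theorem eq_or_eq_swap_of_add_mul_sub_eq {a a' b b' : ℤ × ℤ} {s t : ℝ} (ha : IsGridStep a a')
    (hb : IsGridStep b b') (hs : s ∈ Ico (0 : ℝ) 1) (ht : t ∈ Ico (0 : ℝ) 1)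
    (hfst : (a.1 : ℝ) + s * (a'.1 - a.1) = b.1 + t * (b'.1 - b.1))
    (hsnd : (a.2 : ℝ) + s * (a'.2 - a.2) = b.2 + t * (b'.2 - b.2)) :
    (a = b ∧ s = t) ∨ (a = b' ∧ a' = b) := by
  rcases hs.1.eq_or_lt with rfl | hs0
  · simp only [zero_mul, add_zero] at hfst hsnd
    obtain rfl := eq_zero_of_add_mul_sub_eq hb ht hfst hsnd
    simp only [zero_mul, add_zero, Int.cast_inj] at hfst hsnd
    exact Or.inl ⟨Prod.ext hfst hsnd, rfl⟩
  rcases ht.1.eq_or_lt with rfl | ht0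
  · simp only [zero_mul, add_zero] at hfst hsnd
    exact absurd (eq_zero_of_add_mul_sub_eq ha hs hfst.symm hsnd.symm) hs0.ne'
  rw [IsGridStep] at ha hb
  have hmin1 := floor_add_mul_sub (m := a.1) (m' := a'.1) (by omega) ⟨hs0, hs.2⟩
  have hmax1 := ceil_add_mul_sub (m := a.1) (m' := a'.1) (by omega) ⟨hs0, hs.2⟩
  have hmin2 := floor_add_mul_sub (m := a.2) (m' := a'.2) (by omega) ⟨hs0, hs.2⟩
  have hmax2 := ceil_add_mul_sub (m := a.2) (m' := a'.2) (by omega) ⟨hs0, hs.2⟩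
  rw [hfst, floor_add_mul_sub (by omega) ⟨ht0, ht.2⟩] at hmin1
  rw [hfst, ceil_add_mul_sub (by omega) ⟨ht0, ht.2⟩] at hmax1
  rw [hsnd, floor_add_mul_sub (by omega) ⟨ht0, ht.2⟩] at hmin2
  rw [hsnd, ceil_add_mul_sub (by omega) ⟨ht0, ht.2⟩] at hmax2
  obtain ⟨rfl, rfl⟩ | h : (a = b ∧ a' = b') ∨ (a = b' ∧ a' = b) := by
    simp only [Prod.ext_iff]
    omega
  · refine Or.inl ⟨rfl, ?_⟩
    rw [add_right_inj, mul_eq_mul_right_iff, sub_eq_zero, Int.cast_inj] at hfst hsnd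
    by_contra hst
    simp only [hst, false_or] at hfst hsnd
    omega
  · exact Or.inr h

variable {δ : ℝ} {z w : ℂ}

theorem eq_or_eq_swap_of_gridPoint_add_eq (hδ : 0 < δ) {a a' b b' : ℤ × ℤ} {s t : ℝ}
    (ha : IsGridStep a a') (hb : IsGridStep b b') (hs : s ∈ Ico (0 : ℝ) 1)
    (ht : t ∈ Ico (0 : ℝ) 1)
    (h : gridPoint δ a + s * (gridPoint δ a' - gridPoint δ a) =
      gridPoint δ b + t * (gridPoint δ b' - gridPoint δ b)) :
    (a = b ∧ s = t) ∨ (a = b' ∧ a' = b) := by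
  have hre := congrArg Complex.re h
  have him := congrArg Complex.im h
  simp only [gridPoint, Complex.add_re, Complex.add_im, Complex.re_ofReal_mul,
    Complex.im_ofReal_mul, Complex.sub_re, Complex.sub_im] at hre him
  refine eq_or_eq_swap_of_add_mul_sub_eq ha hb hs ht (mul_left_cancel₀ hδ.ne' ?_)
    (mul_left_cancel₀ hδ.ne' ?_)
  · linear_combination hre
  · linear_combination him

variable (δ q) in
theorem convex_gridSquare : Convex ℝ (gridSquare δ q) :=
  ((convex_Icc _ _).linear_preimage Complex.reLm).inter
    ((convex_Icc _ _).linear_preimage Complex.imLm)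

theorem gridPoint_mem_gridSquare (hδ : 0 < δ) {v : ℤ × ℤ} (h1 : v.1 ∈ Icc q.1 (q.1 + 1))
    (h2 : v.2 ∈ Icc q.2 (q.2 + 1)) : gridPoint δ v ∈ gridSquare δ q := by
  constructor <;> constructor <;> refine mul_le_mul_of_nonneg_left ?_ hδ.le
  · exact_mod_cast h1.1
  · exact_mod_cast h1.2
  · exact_mod_cast h2.1
  · exact_mod_cast h2.2

theorem segment_subset_gridSquare (hδ : 0 < δ) (he : e ∈ squareEdges q) :
    segment ℝ (gridPoint δ e.1) (gridPoint δ e.2) ⊆ gridSquare δ q := by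
  rw [mem_squareEdges] at he
  exact (convex_gridSquare q δ).segment_subset
    (gridPoint_mem_gridSquare hδ ⟨by omega, by omega⟩ ⟨by omega, by omega⟩)
    (gridPoint_mem_gridSquare hδ ⟨by omega, by omega⟩ ⟨by omega, by omega⟩)

theorem eq_of_mem_Ioo_of_mem_Icc (hδ : 0 < δ) {m m' : ℤ} {x : ℝ}
    (hx : x ∈ Ioo (δ * m) (δ * (m + 1))) (hx' : x ∈ Icc (δ * m') (δ * (m' + 1))) : m = m' := by
  have hlt : (m : ℝ) < m' + 1 := lt_of_mul_lt_mul_left (hx.1.trans_le hx'.2) hδ.le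
  have hlt' : (m' : ℝ) < m + 1 := lt_of_mul_lt_mul_left (hx'.1.trans_lt hx.2) hδ.le
  norm_cast at hlt hlt'
  omega

theorem eq_of_mem_openGridSquare (hδ : 0 < δ) (hw : w ∈ openGridSquare δ q)
    (hw' : w ∈ gridSquare δ q') : q = q' :=
  Prod.ext (eq_of_mem_Ioo_of_mem_Icc hδ hw.1 hw'.1) (eq_of_mem_Ioo_of_mem_Icc hδ hw.2 hw'.2)

variable (q) in
theorem gridSquare_subset_closure (hδ : 0 < δ) :
    gridSquare δ q ⊆ closure (openGridSquare δ q) := by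
  have hne (m : ℤ) : δ * m ≠ δ * (m + 1) := (mul_lt_mul_of_pos_left (lt_add_one _) hδ).ne
  rw [openGridSquare, Complex.closure_reProdIm, closure_Ioo (hne _), closure_Ioo (hne _)]
  rfl

theorem mem_Icc_floor_div (hδ : 0 < δ) (x : ℝ) :
    x ∈ Icc (δ * ⌊x / δ⌋) (δ * (⌊x / δ⌋ + 1)) :=
  ⟨(le_div_iff₀' hδ).1 (Int.floor_le _), ((div_lt_iff₀' hδ).1 (Int.lt_floor_add_one _)).le⟩

theorem exists_mem_gridSquare (hδ : 0 < δ) (z : ℂ) : ∃ q, z ∈ gridSquare δ q :=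
  ⟨(⌊z.re / δ⌋, ⌊z.im / δ⌋), mem_Icc_floor_div hδ _, mem_Icc_floor_div hδ _⟩

theorem dist_le_of_mem_gridSquare (hz : z ∈ gridSquare δ q) (hw : w ∈ gridSquare δ q) :
    dist z w ≤ 2 * δ := by
  have hre : |(z - w).re| ≤ δ :=
    (abs_sub_le_of_le_of_le hz.1.1 hz.1.2 hw.1.1 hw.1.2).trans_eq (by ring)
  have him : |(z - w).im| ≤ δ :=
    (abs_sub_le_of_le_of_le hz.2.1 hz.2.2 hw.2.1 hw.2.2).trans_eq (by ring)
  rw [dist_eq_norm]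
  linarith [Complex.norm_le_abs_re_add_abs_im (z - w)]

theorem finite_setOf_gridSquare_inter_nonempty (hδ : 0 < δ) {E : Set ℂ}
    (hE : Bornology.IsBounded E) : {q | (gridSquare δ q ∩ E).Nonempty}.Finite := by
  obtain ⟨R, hR⟩ := hE.subset_closedBall 0
  have habs {m : ℤ} {x : ℝ} (hx : |x| ≤ R) (hm : x ∈ Icc (δ * m) (δ * (m + 1))) :
      ‖m‖ ≤ R / δ + 1 := by
    rw [Int.norm_eq_abs, abs_le, ← sub_le_iff_le_add, neg_add', sub_le_iff_le_add, ← neg_div,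
      div_le_iff₀' hδ, le_div_iff₀' hδ, mul_sub, mul_one]
    exact ⟨(neg_le_of_abs_le hx).trans hm.2, by linarith [hm.1, le_of_abs_le hx]⟩
  refine ((isCompact_closedBall (0 : ℤ × ℤ) (R / δ + 1)).finite_of_discrete).subset ?_
  rintro q ⟨z, hz, hzE⟩
  have hzR : ‖z‖ ≤ R := mem_closedBall_zero_iff.1 (hR hzE)
  exact mem_closedBall_zero_iff.2 (max_le (habs ((Complex.abs_re_le_norm z).trans hzR) hz.1)
    (habs ((Complex.abs_im_le_norm z).trans hzR) hz.2))

end Grid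

section SquareIntegrals

theorem edgeIntegral_vertical (f : ℂ → ℂ) (x y y' : ℝ) :
    edgeIntegral f ⟨x, y⟩ ⟨x, y'⟩ = Complex.I * ∫ t in y..y', f (x + t * Complex.I) := by
  have hsub := intervalIntegral.smul_integral_comp_add_mul (a := 0) (b := 1)
    (fun t : ℝ => f (x + t * Complex.I)) (y' - y) y
  rw [mul_zero, add_zero, mul_one, add_sub_cancel, Complex.real_smul] at hsub
  have hdir : (⟨x, y'⟩ - ⟨x, y⟩ : ℂ) = (y' - y : ℝ) * Complex.I := by apply Complex.ext <;> simp
  have hpoint (s : ℝ) : (⟨x, y⟩ : ℂ) + s * ((y' - y : ℝ) * Complex.I) =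
      x + ((y + (y' - y) * s : ℝ) : ℂ) * Complex.I := by apply Complex.ext <;> simp [mul_comm]
  rw [← hsub, edgeIntegral, intervalIntegral.integral_mul_const, hdir]
  simp only [hpoint]
  ring

theorem edgeIntegral_horizontal (f : ℂ → ℂ) (x x' y : ℝ) :
    edgeIntegral f ⟨x, y⟩ ⟨x', y⟩ = ∫ t in x..x', f (t + y * Complex.I) := by
  have hsub := intervalIntegral.smul_integral_comp_add_mul (a := 0) (b := 1)
    (fun t : ℝ => f (t + y * Complex.I)) (x' - x) x
  rw [mul_zero, add_zero, mul_one, add_sub_cancel, Complex.real_smul] at hsub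
  have hdir : (⟨x', y⟩ - ⟨x, y⟩ : ℂ) = (x' - x : ℝ) := by apply Complex.ext <;> simp
  have hpoint (s : ℝ) : (⟨x, y⟩ : ℂ) + s * (x' - x : ℝ) =
      ((x + (x' - x) * s : ℝ) : ℂ) + y * Complex.I := by apply Complex.ext <;> simp [mul_comm]
  rw [← hsub, edgeIntegral, intervalIntegral.integral_mul_const, hdir]
  simp only [hpoint]
  ring

theorem div_mem_slitPlane {a b w : ℂ} (h : ((b - w) / (a - w)).im ≠ 0) (s : ℝ) :
    (a + s * (b - a) - w) / (a - w) ∈ Complex.slitPlane := by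
  have haw : a - w ≠ 0 := fun h0 => by simp [h0] at h
  have hratio : (a + s * (b - a) - w) / (a - w) = 1 + s * ((b - w) / (a - w) - 1) := by
    field_simp
    ring
  rw [hratio]
  rcases eq_or_ne s 0 with rfl | hs
  · simp
  · exact Or.inr (by simpa using ⟨hs, h⟩)

theorem edgeIntegral_inv_sub {a b w : ℂ} (h : ((b - w) / (a - w)).im ≠ 0) :
    edgeIntegral (fun z => (z - w)⁻¹) a b = Complex.log ((b - w) / (a - w)) := by
  have haw : a - w ≠ 0 := fun h0 => by simp [h0] at h
  have hne (s : ℝ) : a + s * (b - a) - w ≠ 0 :=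
    (div_ne_zero_iff.1 (Complex.slitPlane_ne_zero (div_mem_slitPlane h s))).1
  have hderiv (s : ℝ) : HasDerivAt (fun s : ℝ => Complex.log ((a + s * (b - a) - w) / (a - w)))
      ((a + s * (b - a) - w)⁻¹ * (b - a)) s := by
    have hline : HasDerivAt (fun s : ℝ => a + s * (b - a) - w) (b - a) s := by
      simpa using (((hasDerivAt_id' s).ofReal_comp.mul_const (b - a)).const_add a).sub_const w
    rw [← div_eq_inv_mul, ← div_div_div_cancel_right₀ haw]
    exact (hline.div_const (a - w)).clog_real (div_mem_slitPlane h s)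
  have hcont : Continuous fun s : ℝ => (a + s * (b - a) - w)⁻¹ * (b - a) :=
    (Continuous.inv₀ (by fun_prop) hne).mul continuous_const
  rw [edgeIntegral, intervalIntegral.integral_eq_sub_of_hasDerivAt (fun s _ => hderiv s)
    (hcont.intervalIntegrable 0 1)]
  simp [haw]

-- Turning clockwise by less than a half-turn four times and coming back is one full turn.
theorem log_div_add_log_div_of_im_neg {a b c d : ℂ} (hab : (b / a).im < 0) (hbc : (c / b).im < 0)
    (hcd : (d / c).im < 0) (hda : (a / d).im < 0) :
    Complex.log (b / a) + (Complex.log (c / b) + (Complex.log (d / c) + Complex.log (a / d))) =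
      -(2 * Real.pi * Complex.I) := by
  have hne {z w : ℂ} (h : (w / z).im < 0) : z ≠ 0 ∧ w / z ≠ 0 :=
    ⟨fun h0 => by simp [h0] at h, fun h0 => by simp [h0] at h⟩
  have harg {z : ℂ} (h : z.im < 0) : -Real.pi < z.arg ∧ z.arg < 0 :=
    ⟨Complex.neg_pi_lt_arg z, Complex.arg_neg_iff.2 h⟩
  obtain ⟨n, hn⟩ := Complex.exp_eq_one_iff.1 (show Complex.exp (Complex.log (b / a) +
      (Complex.log (c / b) + (Complex.log (d / c) + Complex.log (a / d)))) = 1 by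
    have := (hne hab).1
    have := (hne hbc).1
    have := (hne hcd).1
    have := (hne hda).1
    rw [Complex.exp_add, Complex.exp_add, Complex.exp_add, Complex.exp_log (hne hab).2,
      Complex.exp_log (hne hbc).2, Complex.exp_log (hne hcd).2, Complex.exp_log (hne hda).2]
    field_simp)
  have him : (b / a).arg + ((c / b).arg + ((d / c).arg + (a / d).arg)) = n * (2 * Real.pi) := by
    simpa [Complex.log_im] using congrArg Complex.im hn
  have hneg : (n : ℝ) < 0 := by nlinarith [harg hab, harg hbc, harg hcd, harg hda, Real.pi_pos]
  have hgt : -2 < (n : ℝ) := by nlinarith [harg hab, harg hbc, harg hcd, harg hda, Real.pi_pos]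
  norm_cast at hneg hgt
  obtain rfl : n = -1 := by omega
  rw [hn]
  push_cast
  ring

theorem im_div_neg {z w : ℂ} (h : z.im * w.re < z.re * w.im) : (z / w).im < 0 := by
  have hw : 0 < Complex.normSq w := Complex.normSq_pos.2 fun h0 => by simp [h0] at h
  rw [Complex.div_im, ← sub_div]
  exact div_neg_of_neg_of_pos (sub_neg.2 h) hw

/-- The integral of `f` over the clockwise boundary of a grid square. -/
def squareIntegral (δ : ℝ) (q : ℤ × ℤ) (f : ℂ → ℂ) : ℂ :=
  ∑ e ∈ squareEdges q, edgeIntegral f (gridPoint δ e.1) (gridPoint δ e.2)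

variable {δ : ℝ} {q : ℤ × ℤ}

theorem squareIntegral_eq_zero (hδ : 0 < δ) {f : ℂ → ℂ}
    (hf : DifferentiableOn ℂ f (gridSquare δ q)) : squareIntegral δ q f = 0 := by
  have hle (m : ℤ) : δ * m ≤ δ * (m + 1) := (mul_lt_mul_of_pos_left (lt_add_one _) hδ).le
  have hrect := Complex.integral_boundary_rect_eq_zero_of_differentiableOn f
    (gridPoint δ q) (gridPoint δ (q.1 + 1, q.2 + 1)) (by
      simp only [gridPoint, Int.cast_add, Int.cast_one]
      rwa [uIcc_of_le (hle _), uIcc_of_le (hle _)])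
  rw [squareIntegral, sum_squareEdges]
  simp only [gridPoint, edgeIntegral_vertical, edgeIntegral_horizontal, smul_eq_mul] at hrect ⊢
  rw [intervalIntegral.integral_symm (δ * q.2), intervalIntegral.integral_symm (δ * q.1)]
  linear_combination -hrect

theorem squareIntegral_inv_sub {w : ℂ} (hw : w ∈ openGridSquare δ q) :
    squareIntegral δ q (fun z => (z - w)⁻¹) = -(2 * Real.pi * Complex.I) := by
  obtain ⟨⟨hx0, hx1⟩, hy0, hy1⟩ := hw
  have hleft : ((gridPoint δ (q.1, q.2 + 1) - w) / (gridPoint δ q - w)).im < 0 :=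
    im_div_neg (by simp [gridPoint]; nlinarith)
  have htop : ((gridPoint δ (q.1 + 1, q.2 + 1) - w) / (gridPoint δ (q.1, q.2 + 1) - w)).im < 0 :=
    im_div_neg (by simp [gridPoint]; nlinarith)
  have hright :
      ((gridPoint δ (q.1 + 1, q.2) - w) / (gridPoint δ (q.1 + 1, q.2 + 1) - w)).im < 0 :=
    im_div_neg (by simp [gridPoint]; nlinarith)
  have hbottom : ((gridPoint δ q - w) / (gridPoint δ (q.1 + 1, q.2) - w)).im < 0 :=
    im_div_neg (by simp [gridPoint]; nlinarith)
  rw [squareIntegral, sum_squareEdges, edgeIntegral_inv_sub hleft.ne, edgeIntegral_inv_sub htop.ne,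
    edgeIntegral_inv_sub hright.ne, edgeIntegral_inv_sub hbottom.ne,
    log_div_add_log_div_of_im_neg hleft htop hright hbottom]

end SquareIntegrals

section AnalyticIntegrals

variable {Y : Type*} [TopologicalSpace Y] [CompactSpace Y] [MeasurableSpace Y]
  [OpensMeasurableSpace Y] {μ : Measure Y} {g : Y → ℂ}

/-- The bounded functional `φ ↦ ∫ φ g dμ` on `C(Y)` given by the complex measure `g μ`. -/
def integralPairing (hg : Integrable g μ) : C(Y, ℂ) →L[ℂ] ℂ :=
  LinearMap.mkContinuous
    { toFun := fun φ => ∫ y, φ y * g y ∂μ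
      map_add' := fun φ ψ => by
        simp only [ContinuousMap.add_apply, add_mul]
        exact integral_add (integrable_continuousMap_mul φ hg) (integrable_continuousMap_mul ψ hg)
      map_smul' := fun c φ => by
        simp only [ContinuousMap.smul_apply, smul_eq_mul, mul_assoc, RingHom.id_apply,
          integral_const_mul] }
    (∫ y, ‖g y‖ ∂μ) fun φ => by
      rw [mul_comm, ← integral_const_mul]
      refine norm_integral_le_of_norm_le (hg.norm.const_mul _) (.of_forall fun y => ?_)
      rw [norm_mul]
      gcongr
      exact φ.norm_coe_le_norm y

/- Inversion is analytic on the units of the Banach algebra `C(Y)`, so no differentiation under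
the integral sign is needed. -/
theorem analyticAt_integral_mul_inv (hg : Integrable g μ) (c d : C(Y, ℂ)) {w₀ : ℂ}
    (h0 : ∀ y, c y - w₀ * d y ≠ 0) :
    AnalyticAt ℂ (fun w => ∫ y, g y * (c y - w * d y)⁻¹ ∂μ) w₀ := by
  have hunit : IsUnit (c - w₀ • d) := (ContinuousMap.isUnit_iff_forall_ne_zero _).2 h0
  have hline : AnalyticAt ℂ (fun w : ℂ => c - w • d) w₀ := by fun_prop
  have hinv : AnalyticAt ℂ (fun w : ℂ => Ring.inverse (c - w • d)) w₀ :=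
    AnalyticAt.fun_comp (analyticAt_inverse (𝕜 := ℂ) hunit.unit) hline
  refine ((integralPairing hg).analyticAt _ |>.fun_comp hinv).congr ?_
  filter_upwards [hline.continuousAt.eventually_mem (Units.isOpen.mem_nhds hunit)] with w hw
  change ∫ y, Ring.inverse (c - w • d) y * g y ∂μ = _
  refine integral_congr_ae (.of_forall fun y => ?_)
  have hone := DFunLike.congr_fun (Ring.inverse_mul_cancel (c - w • d) hw) y
  simp only [ContinuousMap.mul_apply, ContinuousMap.one_apply, ContinuousMap.sub_apply,
    ContinuousMap.smul_apply, smul_eq_mul] at hone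
  change Ring.inverse (c - w • d) y * g y = g y * (c y - w * d y)⁻¹
  rw [eq_inv_of_mul_eq_one_left hone, mul_comm]

end AnalyticIntegrals

section CurveIntegrals

theorem intervalIntegral_eq_integral_unitInterval (f : ℝ → ℂ) :
    ∫ t in (0 : ℝ)..1, f t = ∫ t : unitInterval, f t := by
  rw [intervalIntegral.integral_of_le zero_le_one, ← integral_Icc_eq_integral_Ioc,
    ← integral_subtype_comap measurableSet_Icc]
  rfl

/-- The image of a contour in the plane. -/
def Contour.support (Γ : Contour) : Set ℂ :=
  {z | ∃ γ ∈ Γ, ∃ t ∈ Icc (0 : ℝ) 1, γ.toFun t = z}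

theorem Contour.mem_support {Γ : Contour} {γ : JordanCurve} (hγ : γ ∈ Γ) {t : ℝ}
    (ht : t ∈ Icc (0 : ℝ) 1) : γ.toFun t ∈ Γ.support :=
  ⟨γ, hγ, t, ht, rfl⟩

namespace JordanCurve

/-- The integral of a function along a single curve of a contour. -/
protected def integral (γ : JordanCurve) (f : ℂ → ℂ) : ℂ :=
  ∫ t in (0 : ℝ)..1, f (γ.toFun t) * deriv γ.toFun t

theorem continuous_restrict (γ : JordanCurve) :
    Continuous fun t : unitInterval => γ.toFun t :=
  continuousOn_iff_continuous_domRestrict.1 γ.lipschitz.choose_spec.continuousOn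

theorem integrable_deriv (γ : JordanCurve) :
    Integrable fun t : unitInterval => deriv γ.toFun t := by
  obtain ⟨C, hC⟩ := γ.lipschitz
  refine (integrable_const (C : ℝ)).mono'
    ((measurable_deriv γ.toFun).comp measurable_subtype_coe).aestronglyMeasurable ?_
  filter_upwards [volume.ae_ne (0 : unitInterval), volume.ae_ne (1 : unitInterval)] with t h0 h1
  have hpos : (0 : ℝ) < t := unitInterval.pos_iff_ne_zero.2 h0
  have hlt : (t : ℝ) < 1 := unitInterval.lt_one_iff_ne_one.2 h1
  exact norm_deriv_le_of_lipschitzOn (Icc_mem_nhds hpos hlt) hC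

theorem integral_add (γ : JordanCurve) {f g : ℂ → ℂ} {s : Set ℂ}
    (hs : ∀ t ∈ Icc (0 : ℝ) 1, γ.toFun t ∈ s) (hf : ContinuousOn f s) (hg : ContinuousOn g s) :
    γ.integral (fun z => f z + g z) = γ.integral f + γ.integral g := by
  have hint : ∀ {f : ℂ → ℂ}, ContinuousOn f s →
      Integrable fun t : unitInterval => f (γ.toFun t) * deriv γ.toFun t := fun {f} hf =>
    integrable_continuousMap_mul ⟨fun t : unitInterval => f (γ.toFun t),
      hf.comp_continuous γ.continuous_restrict fun t => hs t t.2⟩ γ.integrable_deriv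
  simp only [JordanCurve.integral, intervalIntegral_eq_integral_unitInterval, add_mul]
  exact MeasureTheory.integral_add (hint hf) (hint hg)

variable {Y : Type*} [TopologicalSpace Y] [CompactSpace Y] [MeasurableSpace Y]
  [BorelSpace Y] [SecondCountableTopology Y] {μ : Measure Y} {g : Y → ℂ}

theorem integrable_kernel_mul_deriv (γ : JordanCurve) {k : ℂ → Y → ℂ} {s : Set ℂ}
    (hs : ∀ t ∈ Icc (0 : ℝ) 1, γ.toFun t ∈ s) (hg : Integrable g μ)
    (hk : ContinuousOn (Function.uncurry k) (s ×ˢ univ)) :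
    Integrable (fun q : unitInterval × Y => k (γ.toFun q.1) q.2 * (deriv γ.toFun q.1 * g q.2))
      (volume.prod μ) :=
  integrable_continuousMap_mul
    ⟨fun q : unitInterval × Y => k (γ.toFun q.1) q.2, hk.comp_continuous
      ((γ.continuous_restrict.comp continuous_fst).prodMk continuous_snd)
      fun q => ⟨hs q.1 q.1.2, mem_univ _⟩⟩ (γ.integrable_deriv.mul_prod hg)

variable [SFinite μ]

theorem integrable_integral_mul (γ : JordanCurve) {k : ℂ → Y → ℂ} {s : Set ℂ}
    (hs : ∀ t ∈ Icc (0 : ℝ) 1, γ.toFun t ∈ s) (hg : Integrable g μ)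
    (hk : ContinuousOn (Function.uncurry k) (s ×ˢ univ)) :
    Integrable (fun y => γ.integral (k · y) * g y) μ := by
  refine (γ.integrable_kernel_mul_deriv hs hg hk).integral_prod_right.congr (.of_forall fun y => ?_)
  simp only [JordanCurve.integral, intervalIntegral_eq_integral_unitInterval, ← mul_assoc,
    integral_mul_const]

theorem integral_integral (γ : JordanCurve) {k : ℂ → Y → ℂ} {s : Set ℂ}
    (hs : ∀ t ∈ Icc (0 : ℝ) 1, γ.toFun t ∈ s) (hg : Integrable g μ)
    (hk : ContinuousOn (Function.uncurry k) (s ×ˢ univ)) :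
    γ.integral (fun z => ∫ y, k z y * g y ∂μ) = ∫ y, γ.integral (k · y) * g y ∂μ := by
  simp only [JordanCurve.integral, intervalIntegral_eq_integral_unitInterval, ← integral_mul_const]
  rw [integral_integral_swap]
  · simp only [mul_right_comm]
  · refine (γ.integrable_kernel_mul_deriv hs hg hk).congr (.of_forall fun q => ?_)
    change _ = k (γ.toFun q.1) q.2 * g q.2 * deriv γ.toFun q.1
    ring

end JordanCurve

namespace Contour

theorem integral_cons (γ : JordanCurve) (Γ : List JordanCurve) (f : ℂ → ℂ) :
    Contour.integral (γ :: Γ) f = γ.integral f + Contour.integral Γ f := by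
  simp only [Contour.integral, JordanCurve.integral, List.map_cons, List.sum_cons]

theorem support_cons (γ : JordanCurve) (Γ : List JordanCurve) :
    support (γ :: Γ) = γ.toFun '' Icc 0 1 ∪ support Γ := by
  ext z
  simp only [support, List.mem_cons, exists_eq_or_imp, mem_union, mem_image, mem_ofPred_eq]

theorem integral_congr {Γ : Contour} {f g : ℂ → ℂ} (h : EqOn f g Γ.support) :
    Γ.integral f = Γ.integral g := by
  refine congrArg List.sum (List.map_congr_left fun γ hγ => intervalIntegral.integral_congr ?_)
  intro t ht
  rw [uIcc_of_le zero_le_one] at ht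
  simp only [h (mem_support hγ ht)]

theorem integral_const_mul (Γ : Contour) (c : ℂ) (f : ℂ → ℂ) :
    Γ.integral (fun z => c * f z) = c * Γ.integral f := by
  simp only [Contour.integral, mul_assoc, intervalIntegral.integral_const_mul,
    List.sum_map_mul_left]

theorem integral_add {Γ : Contour} {f g : ℂ → ℂ} (hf : ContinuousOn f Γ.support)
    (hg : ContinuousOn g Γ.support) :
    Γ.integral (fun z => f z + g z) = Γ.integral f + Γ.integral g := by
  simp only [Contour.integral, ← List.sum_map_add]
  exact congrArg List.sum (List.map_congr_left fun γ hγ =>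
    γ.integral_add (fun _ => mem_support hγ) hf hg)

theorem integral_integral {Y : Type*} [TopologicalSpace Y] [CompactSpace Y] [MeasurableSpace Y]
    [BorelSpace Y] [SecondCountableTopology Y] {μ : Measure Y} [SFinite μ]
    {g : Y → ℂ} {Γ : Contour} {k : ℂ → Y → ℂ} (hg : Integrable g μ)
    (hk : ContinuousOn (Function.uncurry k) (Γ.support ×ˢ univ)) :
    Γ.integral (fun z => ∫ y, k z y * g y ∂μ) = ∫ y, Γ.integral (k · y) * g y ∂μ := by
  have hint : ∀ γ ∈ Γ, Integrable (fun y => γ.integral (k · y) * g y) μ := fun γ hγ =>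
    γ.integrable_integral_mul (fun _ => mem_support hγ) hg hk
  calc Γ.integral (fun z => ∫ y, k z y * g y ∂μ)
      = (Γ.map fun γ => ∫ y, γ.integral (k · y) * g y ∂μ).sum :=
        congrArg List.sum (List.map_congr_left fun γ hγ =>
          γ.integral_integral (fun _ => mem_support hγ) hg hk)
    _ = ∫ y, (Γ.map fun γ => γ.integral (k · y) * g y).sum ∂μ := by
        simp only [← Fin.sum_univ_fun_getElem]
        exact (integral_finsetSum _ fun i _ => hint _ (List.getElem_mem _)).symm
    _ = ∫ y, Γ.integral (k · y) * g y ∂μ := by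
        simp only [List.sum_map_mul_right]
        rfl

end Contour

end CurveIntegrals

section SeparatingContours

variable {V : Type*} {P : V → ℂ} {S : Finset (V × V)}

/-- The contour `Γ` runs exactly once along each of the directed edges in `S`, where the vertices
are placed in the plane by `P`. -/
structure Contour.Traverses (Γ : Contour) (P : V → ℂ) (S : Finset (V × V)) : Prop where
  mem_segment : ∀ z ∈ Γ.support, ∃ e ∈ S, z ∈ segment ℝ (P e.1) (P e.2)
  integral_eq : ∀ f : ℂ → ℂ, (∀ e ∈ S, ContinuousOn f (segment ℝ (P e.1) (P e.2))) →
    Γ.integral f = ∑ e ∈ S, edgeIntegral f (P e.1) (P e.2)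

theorem Contour.Traverses.cons_polylineCurve [DecidableEq V] {Γ : List JordanCurve} {k : ℕ}
    {c : ℕ → V} (hc : IsSimpleCycle k c) (hsub : walkEdges k c ⊆ S)
    (hΓ : Contour.Traverses Γ P (S \ walkEdges k c))
    (hinj : ∀ i < k, ∀ j < k, ∀ s ∈ Ico (0 : ℝ) 1, ∀ t ∈ Ico (0 : ℝ) 1,
      P (c i) + s * (P (c (i + 1)) - P (c i)) = P (c j) + t * (P (c (j + 1)) - P (c j)) →
      i = j ∧ s = t) :
    Contour.Traverses
      (polylineCurve (P ∘ c) k hc.pos (congrArg P hc.closed) hinj :: Γ) P S where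
  mem_segment z hz := by
    rw [Contour.support_cons] at hz
    rcases hz with ⟨t, ht, rfl⟩ | hz
    · obtain ⟨i, hi, hmem⟩ := polyline_mem_segment (P ∘ c) hc.pos ht
      exact ⟨_, hsub (Finset.mem_image_of_mem _ (Finset.mem_range.2 hi)), hmem⟩
    · obtain ⟨e, he, hmem⟩ := hΓ.mem_segment z hz
      exact ⟨e, Finset.sdiff_subset he, hmem⟩
  integral_eq f hf := by
    have hcurve : ∀ i < k, ContinuousOn f (segment ℝ ((P ∘ c) i) ((P ∘ c) (i + 1))) :=
      fun i hi => hf _ (hsub (Finset.mem_image_of_mem _ (Finset.mem_range.2 hi)))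
    rw [Contour.integral_cons, hΓ.integral_eq f fun e he => hf e (Finset.sdiff_subset he),
      ← Finset.sum_sdiff hsub, add_comm, hc.sum_walkEdges]
    exact congrArg _ (integral_polyline (P ∘ c) hc.pos hcurve)

theorem BalancedEdges.exists_traverses (hS : BalancedEdges S)
    (hinj : ∀ e ∈ S, ∀ e' ∈ S, ∀ s ∈ Ico (0 : ℝ) 1, ∀ t ∈ Ico (0 : ℝ) 1,
      P e.1 + s * (P e.2 - P e.1) = P e'.1 + t * (P e'.2 - P e'.1) → e.1 = e'.1 ∧ s = t) :
    ∃ Γ : Contour, Γ.Traverses P S := by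
  classical
  revert hinj
  refine BalancedEdges.induction (motive := fun S => (∀ e ∈ S, ∀ e' ∈ S, ∀ s ∈ Ico (0 : ℝ) 1,
      ∀ t ∈ Ico (0 : ℝ) 1, P e.1 + s * (P e.2 - P e.1) = P e'.1 + t * (P e'.2 - P e'.1) →
      e.1 = e'.1 ∧ s = t) → ∃ Γ : Contour, Γ.Traverses P S)
    (fun _ => ⟨[], by simp [Contour.support], by simp [Contour.integral]⟩)
    (fun S k c hc hsub ih hinj => ?_) hS
  obtain ⟨Γ, hΓ⟩ := ih fun e he e' he' =>
    hinj e (Finset.sdiff_subset he) e' (Finset.sdiff_subset he')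
  have hmem : ∀ i < k, (c i, c (i + 1)) ∈ S := fun i hi =>
    hsub (Finset.mem_image_of_mem _ (Finset.mem_range.2 hi))
  refine ⟨_, hΓ.cons_polylineCurve hc hsub fun i hi j hj s hs t ht h => ?_⟩
  obtain ⟨hij, hst⟩ := hinj _ (hmem i hi) _ (hmem j hj) s hs t ht h
  exact ⟨hc.injOn hi hj hij, hst⟩

theorem exists_traverses_boundaryEdges {δ : ℝ} (hδ : 0 < δ) (A : Finset (ℤ × ℤ)) :
    ∃ Γ : Contour, Γ.Traverses (gridPoint δ) (boundaryEdges A) := by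
  refine (balancedEdges_boundaryEdges A).exists_traverses fun e he e' he' s hs t ht h => ?_
  refine (eq_or_eq_swap_of_gridPoint_add_eq hδ (isGridStep_of_mem_boundaryEdges he)
    (isGridStep_of_mem_boundaryEdges he') hs ht h).resolve_right fun hswap => ?_
  have : e' = e.swap := Prod.ext hswap.2.symm hswap.1.symm
  exact swap_notMem_boundaryEdges he (this ▸ he')

theorem sum_edgeIntegral_boundaryEdges (δ : ℝ) (A : Finset (ℤ × ℤ)) (f : ℂ → ℂ) :
    ∑ e ∈ boundaryEdges A, edgeIntegral f (gridPoint δ e.1) (gridPoint δ e.2) =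
      ∑ q ∈ A, squareIntegral δ q f :=
  sum_boundaryEdges fun _ => edgeIntegral_swap f _ _

theorem differentiableOn_inv_sub {s : Set ℂ} {w : ℂ} (hw : w ∉ s) :
    DifferentiableOn ℂ (fun z => (z - w)⁻¹) s :=
  .inv (by fun_prop) fun _ hz h => hw (sub_eq_zero.1 h ▸ hz)

theorem continuousAt_edgeIntegral_inv_sub {a b y : ℂ} (hy : y ∉ segment ℝ a b) :
    ContinuousAt (fun w => edgeIntegral (fun z => (z - w)⁻¹) a b) y := by
  have hana := analyticAt_integral_mul_inv (Y := unitInterval) (μ := volume)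
    (integrable_const (b - a)) ⟨fun s => a + ((s : ℝ) : ℂ) * (b - a), by fun_prop⟩ 1 (w₀ := y)
    fun s h => hy (by
      rw [ContinuousMap.one_apply, mul_one, sub_eq_zero] at h
      exact h ▸ add_mul_sub_mem_segment s.2)
  refine hana.continuousAt.congr (.of_forall fun w => ?_)
  simp only [edgeIntegral, intervalIntegral_eq_integral_unitInterval, ContinuousMap.coe_mk,
    ContinuousMap.one_apply, mul_one, mul_comm (b - a)]

theorem sum_squareIntegral_inv_sub {δ : ℝ} (hδ : 0 < δ) {A : Finset (ℤ × ℤ)} {q : ℤ × ℤ}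
    (hq : q ∈ A) {w : ℂ} (hw : w ∈ openGridSquare δ q) :
    ∑ q' ∈ A, squareIntegral δ q' (fun z => (z - w)⁻¹) = -(2 * Real.pi * Complex.I) := by
  rw [Finset.sum_eq_single_of_mem q hq fun q' _ hne => squareIntegral_eq_zero hδ <|
    differentiableOn_inv_sub fun hw' => hne (eq_of_mem_openGridSquare hδ hw hw').symm]
  exact squareIntegral_inv_sub hw

/- The point `y` may lie on a common side of two squares of `A`; it is approached from the inside
of one of them. -/
theorem sum_edgeIntegral_boundaryEdges_inv_sub {δ : ℝ} (hδ : 0 < δ) {A : Finset (ℤ × ℤ)} {y : ℂ}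
    (hy : ∀ q, y ∈ gridSquare δ q → q ∈ A)
    (hseg : ∀ e ∈ boundaryEdges A, y ∉ segment ℝ (gridPoint δ e.1) (gridPoint δ e.2)) :
    ∑ e ∈ boundaryEdges A, edgeIntegral (fun z => (z - y)⁻¹) (gridPoint δ e.1) (gridPoint δ e.2) =
      -(2 * Real.pi * Complex.I) := by
  obtain ⟨q, hq⟩ := exists_mem_gridSquare hδ y
  have hcont : ContinuousAt (fun w => ∑ e ∈ boundaryEdges A,
      edgeIntegral (fun z => (z - w)⁻¹) (gridPoint δ e.1) (gridPoint δ e.2)) y :=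
    tendsto_finsetSum _ fun e he => continuousAt_edgeIntegral_inv_sub (hseg e he)
  have : (𝓝[openGridSquare δ q] y).NeBot :=
    mem_closure_iff_nhdsWithin_neBot.1 (gridSquare_subset_closure q hδ hq)
  refine tendsto_nhds_unique_of_eventuallyEq
    (hcont.continuousWithinAt (s := openGridSquare δ q)).tendsto tendsto_const_nhds ?_
  filter_upwards [self_mem_nhdsWithin] with w hw
  rw [sum_edgeIntegral_boundaryEdges, sum_squareIntegral_inv_sub hδ (hy q hq) hw]

theorem exists_grid_cover {E F : Set ℂ} (hE : IsCompact E) (hF : IsClosed F)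
    (hEF : Disjoint E F) :
    ∃ δ > 0, ∃ A : Finset (ℤ × ℤ),
      (∀ q, q ∈ A ↔ (gridSquare δ q ∩ E).Nonempty) ∧ ∀ q ∈ A, gridSquare δ q ⊆ Fᶜ := by
  obtain ⟨d, hd, hdist⟩ := Metric.exists_pos_forall_lt_edist hE hF hEF
  have hδ : (0 : ℝ) < d / 3 := by positivity
  set A := (finite_setOf_gridSquare_inter_nonempty hδ hE.isBounded).toFinset
  have hA : ∀ q, q ∈ A ↔ (gridSquare (d / 3 : ℝ) q ∩ E).Nonempty := fun q =>
    Set.Finite.mem_toFinset _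
  refine ⟨d / 3, hδ, A, hA, fun q hq w hw hwF => ?_⟩
  obtain ⟨y, hyq, hyE⟩ := (hA q).1 hq
  have hfar : (d : ℝ) < dist y w := by
    rw [← coe_nndist, NNReal.coe_lt_coe, ← ENNReal.coe_lt_coe, ← edist_nndist]
    exact hdist y hyE w hwF
  linarith [dist_le_of_mem_gridSquare hyq hw]

/-- The contour `Γ` separates `E` from `F`: it winds `-1` times around the points of `E`, and
Cauchy's theorem holds for the functions holomorphic off `F`. -/
structure Contour.Separates (Γ : Contour) (E F : Set ℂ) : Prop where
  disjoint_left : Disjoint Γ.support E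
  disjoint_right : Disjoint Γ.support F
  integral_eq_zero : ∀ f : ℂ → ℂ, DifferentiableOn ℂ f Fᶜ → Γ.integral f = 0
  integral_inv_sub : ∀ y ∈ E, Γ.integral (fun z => (z - y)⁻¹) = -(2 * Real.pi * Complex.I)

theorem exists_contour_separates {E F : Set ℂ} (hE : IsCompact E) (hF : IsClosed F)
    (hEF : Disjoint E F) : ∃ Γ : Contour, Γ.Separates E F := by
  obtain ⟨δ, hδ, A, hA, hAF⟩ := exists_grid_cover hE hF hEF
  obtain ⟨Γ, hΓ⟩ := exists_traverses_boundaryEdges hδ A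
  have hsegF : ∀ e ∈ boundaryEdges A, segment ℝ (gridPoint δ e.1) (gridPoint δ e.2) ⊆ Fᶜ :=
    fun e he => by
      obtain ⟨q, hq, -, -, heq, -⟩ := exists_mem_squareEdges_of_mem_boundaryEdges he
      exact (segment_subset_gridSquare hδ heq).trans (hAF q hq)
  have hsegE : ∀ e ∈ boundaryEdges A, ∀ z ∈ segment ℝ (gridPoint δ e.1) (gridPoint δ e.2), z ∉ E :=
    fun e he z hz hzE => by
      obtain ⟨-, -, q, hq, -, heq⟩ := exists_mem_squareEdges_of_mem_boundaryEdges he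
      rw [segment_symm] at hz
      exact hq ((hA q).2 ⟨z, segment_subset_gridSquare hδ heq hz, hzE⟩)
  refine ⟨Γ, disjoint_left.2 fun z hz => ?_, disjoint_left.2 fun z hz => ?_, fun f hf => ?_,
    fun y hy => ?_⟩
  · obtain ⟨e, he, hze⟩ := hΓ.mem_segment z hz
    exact hsegE e he z hze
  · obtain ⟨e, he, hze⟩ := hΓ.mem_segment z hz
    exact hsegF e he hze
  · rw [hΓ.integral_eq f fun e he => hf.continuousOn.mono (hsegF e he),
      sum_edgeIntegral_boundaryEdges]
    exact Finset.sum_eq_zero fun q hq => squareIntegral_eq_zero hδ (hf.mono (hAF q hq))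
  · have hseg : ∀ e ∈ boundaryEdges A, y ∉ segment ℝ (gridPoint δ e.1) (gridPoint δ e.2) :=
      fun e he hye => hsegE e he y hye hy
    rw [hΓ.integral_eq _ fun e he => (differentiableOn_inv_sub (hseg e he)).continuousOn]
    exact sum_edgeIntegral_boundaryEdges_inv_sub hδ (fun q hq => (hA q).2 ⟨y, hq, hy⟩) hseg

namespace Contour.Separates

variable {Γ : Contour} {E F : Set ℂ}

theorem index_of_mem_left (hΓ : Γ.Separates E F) {y : ℂ} (hy : y ∈ E) : Γ.index y = -1 := by
  change (2 * Real.pi * Complex.I)⁻¹ * Γ.integral (fun ξ => (ξ - y)⁻¹) = -1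
  rw [hΓ.integral_inv_sub y hy, mul_neg, inv_mul_cancel₀ Complex.two_pi_I_ne_zero]

theorem index_of_mem_right (hΓ : Γ.Separates E F) {w : ℂ} (hw : w ∈ F) : Γ.index w = 0 := by
  change (2 * Real.pi * Complex.I)⁻¹ * Γ.integral (fun ξ => (ξ - w)⁻¹) = 0
  rw [hΓ.integral_eq_zero _ (differentiableOn_inv_sub (not_not_intro hw)), mul_zero]

/- Cauchy's formula: `(f z - f y) / (z - y)` extends holomorphically across `y`, so its integral
vanishes. -/
theorem integral_mul_inv_sub (hΓ : Γ.Separates E F) (hF : IsClosed F) {f : ℂ → ℂ}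
    (hf : DifferentiableOn ℂ f Fᶜ) {y : ℂ} (hy : y ∈ E) :
    Γ.integral (fun z => f z * (z - y)⁻¹) = -(2 * Real.pi * Complex.I) * f y := by
  have hyF : y ∉ F := fun h => by simpa [hΓ.index_of_mem_right h] using hΓ.index_of_mem_left hy
  have hne : y ∉ Γ.support := Set.disjoint_right.1 hΓ.disjoint_left hy
  have hslope : DifferentiableOn ℂ (dslope f y) Fᶜ :=
    (Complex.differentiableOn_dslope (hF.isOpen_compl.mem_nhds hyF)).2 hf
  have hsplit : EqOn (fun z => f z * (z - y)⁻¹) (fun z => dslope f y z + f y * (z - y)⁻¹)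
      Γ.support := fun z hz => by
    have hzy : z ≠ y := fun h => hne (h ▸ hz)
    simp only [dslope_of_ne f hzy, slope_def_field]
    ring
  have hsub : Γ.support ⊆ Fᶜ := Set.subset_compl_iff_disjoint_right.2 hΓ.disjoint_right
  have hinv : ContinuousOn (fun z => f y * (z - y)⁻¹) Γ.support :=
    continuousOn_const.mul (differentiableOn_inv_sub hne).continuousOn
  rw [integral_congr hsplit, integral_add (hslope.continuousOn.mono hsub) hinv, integral_const_mul,
    hΓ.integral_eq_zero _ hslope, hΓ.integral_inv_sub y hy]
  ring

theorem admissible {F : Set (OnePoint ℂ)}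
    (hΓ : Γ.Separates E ((↑) ⁻¹' F)) : Γ.Admissible F ((↑) '' E)ᶜ := by
  refine ⟨fun γ hγ t ht => ⟨?_, ?_⟩, -1, fun z hz => ?_, fun w hw => ?_⟩
  · rintro ⟨y, hy, hyt⟩
    rw [OnePoint.coe_eq_coe] at hyt
    exact Set.disjoint_left.1 hΓ.disjoint_left (mem_support hγ ht) (hyt ▸ hy)
  · exact Set.disjoint_left.1 hΓ.disjoint_right (mem_support hγ ht)
  · rw [Int.cast_neg, Int.cast_one, neg_add_cancel]
    cases z with
    | infty => rfl
    | coe w => exact hΓ.index_of_mem_right hz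
  · obtain ⟨y, hy, rfl⟩ := not_not.1 hw
    rw [hΓ.index_of_mem_left hy, Int.cast_neg, Int.cast_one]

end Contour.Separates

end SeparatingContours

section CauchyTransform

variable {E : Set ℂ} {μ : Measure E} {g : E → ℂ}

/-- The Cauchy transform `z ↦ ∫ g(y) / (y - z) dμ(y)`, which is `0` at `∞`. -/
def cauchyTransform (μ : Measure E) (g : E → ℂ) : OnePoint ℂ → ℂ
  | none => 0
  | some z => ∫ y : E, ((y : ℂ) - z)⁻¹ * g y ∂μ

theorem cauchyTransform_infty : cauchyTransform μ g OnePoint.infty = 0 := rfl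

theorem cauchyTransform_coe (z : ℂ) :
    cauchyTransform μ g z = ∫ y : E, ((y : ℂ) - z)⁻¹ * g y ∂μ := rfl

theorem cauchyTransform_sphereInv (ζ : ℂ) :
    cauchyTransform μ g (sphereInv ζ) = -ζ * ∫ y : E, g y * (1 - ζ * (y : ℂ))⁻¹ ∂μ := by
  by_cases hζ : ζ = 0
  · rw [sphereInv, if_pos hζ, hζ, neg_zero, zero_mul, cauchyTransform_infty]
  · rw [sphereInv, if_neg hζ, cauchyTransform_coe, ← integral_const_mul]
    refine integral_congr_ae (.of_forall fun y => ?_)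
    have hfactor : (y : ℂ) - ζ⁻¹ = (-ζ)⁻¹ * (1 - ζ * y) := by
      field_simp
      ring
    change ((y : ℂ) - ζ⁻¹)⁻¹ * g y = -ζ * (g y * (1 - ζ * (y : ℂ))⁻¹)
    rw [hfactor, mul_inv, inv_inv]
    ring

theorem SphereAnalyticAt.continuousAt {f : OnePoint ℂ → ℂ} {z : OnePoint ℂ}
    (h : SphereAnalyticAt f z) : ContinuousAt f z := by
  cases z with
  | coe w => exact OnePoint.continuousAt_coe.2 (AnalyticAt.continuousAt h)
  | infty =>
    have hcont : ContinuousAt (fun ζ => f (sphereInv ζ)) 0 := AnalyticAt.continuousAt h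
    have hzero : sphereInv 0 = OnePoint.infty := if_pos rfl
    rw [OnePoint.continuousAt_infty', Filter.coclosedCompact_eq_cocompact,
      ← Metric.cobounded_eq_cocompact, ← hzero]
    refine (hcont.tendsto.comp Filter.tendsto_inv₀_cobounded).congr' ?_
    filter_upwards [Bornology.eventually_ne_cobounded (0 : ℂ)] with w hw
    simp [sphereInv, hw]

variable [CompactSpace E]

theorem sphereAnalyticAt_cauchyTransform (hg : Integrable g μ) {z : OnePoint ℂ}
    (hz : z ∉ (↑) '' E) : SphereAnalyticAt (cauchyTransform μ g) z := by
  let ι : C(E, ℂ) := ⟨Subtype.val, continuous_subtype_val⟩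
  cases z with
  | coe w =>
    refine (analyticAt_integral_mul_inv hg ι 1 (w₀ := w) fun y h => hz ⟨y, y.2, ?_⟩).congr
      (.of_forall fun ζ => ?_)
    · rw [ContinuousMap.one_apply, mul_one, sub_eq_zero] at h
      exact congrArg _ h
    · simp only [ContinuousMap.one_apply, mul_one, cauchyTransform_coe, mul_comm (g _)]
      rfl
  | infty =>
    have hana : AnalyticAt ℂ (fun ζ => ∫ y : E, g y * (1 - ζ * (y : ℂ))⁻¹ ∂μ) 0 :=
      analyticAt_integral_mul_inv hg 1 ι fun y => by simp
    change AnalyticAt ℂ (fun ζ => cauchyTransform μ g (sphereInv ζ)) 0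
    simp only [cauchyTransform_sphereInv]
    exact analyticAt_id.neg.mul hana

theorem memH_cauchyTransform (hg : Integrable g μ) :
    MemH ((↑) '' E)ᶜ (cauchyTransform μ g) :=
  ⟨fun _ hz => sphereAnalyticAt_cauchyTransform hg hz, fun _ => cauchyTransform_infty⟩

end CauchyTransform

section Polynomials

open Polynomial

theorem exists_eval_sub_eval_eq {R : Type*} [CommRing R] [Nontrivial R] [TopologicalSpace R]
    [IsTopologicalRing R] {r : R[X]} {n : ℕ} (hr : r.natDegree ≤ n) :
    ∃ c : Fin n → C(R, R),
      ∀ y z, r.eval z - r.eval y = (z - y) * ∑ j, c j y * z ^ (j : ℕ) := by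
  refine ⟨fun j => ⟨fun y => (r /ₘ (X - C y)).coeff j, ?_⟩, fun y z => ?_⟩
  · simp only [coeff_divByMonic_X_sub_C]
    fun_prop
  have hdeg : (r /ₘ (X - C y)).degree < n := by
    rcases eq_or_ne r 0 with rfl | hr0
    · rw [zero_divByMonic, degree_zero]
      exact WithBot.bot_lt_coe n
    · exact (degree_divByMonic_lt _ _ hr0 (by rw [degree_X_sub_C]; exact one_pos)).trans_le
        (degree_le_of_natDegree_le hr)
  have hquot : r.eval z = r.eval y + (z - y) * (r /ₘ (X - C y)).eval z := by
    have h := congrArg (eval z) (modByMonic_add_div r (X - C y))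
    rw [modByMonic_X_sub_C_eq_C_eval, eval_add, eval_C, eval_mul, eval_sub, eval_X, eval_C] at h
    exact h.symm
  simp only [ContinuousMap.coe_mk]
  rw [sum_fin (fun j a => a * z ^ j) (fun j => zero_mul _) hdeg, ← eval_eq_sum, hquot,
    add_sub_cancel_left]

theorem exists_fin_forall_eval_eq_zero {R : Type*} [CommRing R] [IsDomain R] {q : R[X]}
    (hq : q ≠ 0) {n : ℕ} (hn : q.natDegree ≤ n) :
    ∃ r : Fin n → R, ∀ z, q.eval z = 0 → z ∈ range r := by
  refine ⟨fun i => q.roots.toList.getD i 0, fun z hz => ?_⟩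
  obtain ⟨i, hi, rfl⟩ := List.getElem_of_mem (Multiset.mem_toList.2 ((mem_roots hq).2 hz))
  have hlen : i < n := hi.trans_le <| by
    rw [Multiset.length_toList]
    exact (card_roots' q).trans hn
  exact ⟨⟨i, hlen⟩, List.getD_eq_getElem _ _ hi⟩

end Polynomials

section ZolotarevKernel

theorem ratFunc_eval_id {k : Type*} [Field k] (φ : RatFunc k) (z : k) :
    φ.eval (RingHom.id k) z = φ.num.eval z / φ.denom.eval z := by
  rw [RatFunc.eval, Polynomial.eval₂_id, Polynomial.eval₂_id]

theorem zolotarevKernel_infty (φ : RatFunc ℂ) (y : ℂ) :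
    zolotarevKernel φ OnePoint.infty y = 0 := rfl

theorem zolotarevKernel_coe (φ : RatFunc ℂ) (z y : ℂ) :
    zolotarevKernel φ z y =
      (φ.eval (RingHom.id ℂ) z)⁻¹ * φ.eval (RingHom.id ℂ) y / (y - z) := rfl

theorem zolotarevKernel_eq_inv_sub_sub {φ : RatFunc ℂ} {z y a b : ℂ} (hz : φ.num.eval z ≠ 0)
    (hy : φ.denom.eval y ≠ 0) (hyz : y ≠ z) (ha : φ.num.eval z - φ.num.eval y = (z - y) * a)
    (hb : φ.denom.eval z - φ.denom.eval y = (z - y) * b) :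
    zolotarevKernel φ z y =
      (y - z)⁻¹ - (b * φ.eval (RingHom.id ℂ) y - a) / φ.num.eval z := by
  have hsub : y - z ≠ 0 := sub_ne_zero.2 hyz
  simp only [zolotarevKernel_coe, ratFunc_eval_id, inv_div]
  field_simp
  linear_combination φ.num.eval y * hb - φ.denom.eval y * ha

theorem continuous_inv_sub {E : Set ℂ} {z : ℂ} (hz : z ∉ E) :
    Continuous fun y : E => ((y : ℂ) - z)⁻¹ :=
  .inv₀ (by fun_prop) fun y h => hz (sub_eq_zero.1 h ▸ y.2)

variable {E : Set ℂ} {μ : Measure E}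

/-- The functional `g ↦ ∫ w g dμ` on `L²(μ)`, for a weight `w` with which every `L²` function has
an integrable product; no boundedness is claimed. -/
def weightFunctional (w : E → ℂ) (hw : ∀ g : Lp ℂ 2 μ, Integrable (fun y => w y * g y) μ) :
    Lp ℂ 2 μ →ₗ[ℂ] ℂ where
  toFun g := ∫ y, w y * g y ∂μ
  map_add' g₁ g₂ := by
    rw [← integral_add (hw g₁) (hw g₂)]
    refine integral_congr_ae ?_
    filter_upwards [Lp.coeFn_add g₁ g₂] with y hy
    rw [hy, Pi.add_apply, mul_add]
  map_smul' c g := by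
    rw [RingHom.id_apply, smul_eq_mul, ← integral_const_mul]
    refine integral_congr_ae ?_
    filter_upwards [Lp.coeFn_smul c g] with y hy
    rw [hy, Pi.smul_apply, smul_eq_mul, mul_left_comm]

variable [CompactSpace E] {φ : RatFunc ℂ} {n : ℕ}

theorem integrable_inv_sub_mul {z : ℂ} (hz : z ∉ E) {g : E → ℂ} (hg : Integrable g μ) :
    Integrable (fun y : E => ((y : ℂ) - z)⁻¹ * g y) μ :=
  integrable_continuousMap_mul ⟨_, continuous_inv_sub hz⟩ hg

theorem integrable_eval_mul_of_integrable_zolotarevKernel_mul {z : ℂ} (hz : z ∉ E)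
    (hnum : φ.num.eval z ≠ 0) (hden : φ.denom.eval z ≠ 0) {g : E → ℂ}
    (hg : Integrable (fun y : E => zolotarevKernel φ z y * g y) μ) :
    Integrable (fun y : E => φ.eval (RingHom.id ℂ) y * g y) μ := by
  let w : C(E, ℂ) := ⟨fun y => φ.num.eval z / φ.denom.eval z * ((y : ℂ) - z), by fun_prop⟩
  refine (integrable_continuousMap_mul w hg).congr (.of_forall fun y => ?_)
  have hyz : (y : ℂ) - z ≠ 0 := fun h => hz (sub_eq_zero.1 h ▸ y.2)
  simp only [w, ContinuousMap.coe_mk, zolotarevKernel_coe, ratFunc_eval_id φ z]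
  field_simp

theorem exists_integral_zolotarevKernel_mul_eq [IsFiniteMeasure μ] (hnum : φ.num.natDegree ≤ n)
    (hden : φ.denom.natDegree ≤ n) (hE : ∀ᵐ y : E ∂μ, φ.denom.eval (y : ℂ) ≠ 0)
    (hφ : ∀ g : Lp ℂ 2 μ, Integrable (fun y : E => φ.eval (RingHom.id ℂ) y * g y) μ) :
    ∃ l : Lp ℂ 2 μ →ₗ[ℂ] (Fin n → ℂ), ∀ g, l g = 0 → ∀ z : OnePoint ℂ, z ∉ (↑) '' E →
      NonvanishingAt φ z → ∫ y : E, zolotarevKernel φ z y * g y ∂μ = cauchyTransform μ g z := by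
  obtain ⟨a, ha⟩ := exists_eval_sub_eval_eq hnum
  obtain ⟨b, hb⟩ := exists_eval_sub_eval_eq hden
  set w : Fin n → E → ℂ := fun j y => b j y * φ.eval (RingHom.id ℂ) y - a j y
  have hw : ∀ j, ∀ g : Lp ℂ 2 μ, Integrable (fun y => w j y * g y) μ := fun j g => by
    have hbφ := integrable_continuousMap_mul ((b j).restrict E) (hφ g)
    have hag := integrable_continuousMap_mul ((a j).restrict E) (integrable_coeFn_L2 g)
    refine (hbφ.sub hag).congr (.of_forall fun y => ?_)
    simp only [w, Pi.sub_apply, ContinuousMap.restrict_apply, sub_mul, mul_assoc]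
  refine ⟨LinearMap.pi fun j => weightFunctional (w j) (hw j), fun g hg z hzE hz => ?_⟩
  cases z with
  | infty => simp only [zolotarevKernel_infty, zero_mul, integral_zero, cauchyTransform_infty]
  | coe z =>
    have hzE' : z ∉ E := fun h => hzE (mem_image_of_mem _ h)
    have hwg : ∀ j, ∫ y, w j y * g y ∂μ = 0 := congrFun hg
    have hterm : ∀ j ∈ (Finset.univ : Finset (Fin n)), Integrable
        (fun y => z ^ (j : ℕ) / φ.num.eval z * (w j y * g y)) μ := fun j _ => (hw j g).const_mul _
    calc ∫ y : E, zolotarevKernel φ z y * g y ∂μ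
        = ∫ y : E, ((y : ℂ) - z)⁻¹ * g y -
            ∑ j : Fin n, z ^ (j : ℕ) / φ.num.eval z * (w j y * g y) ∂μ := by
          refine integral_congr_ae ?_
          filter_upwards [hE] with y hy
          rw [zolotarevKernel_eq_inv_sub_sub hz hy (fun h => hzE' (h ▸ y.2)) (ha y z) (hb y z),
            sub_mul]
          simp only [w, Finset.sum_mul, Finset.sum_div, ← Finset.sum_sub_distrib]
          congr 1
          exact Finset.sum_congr rfl fun j _ => by ring
      _ = cauchyTransform μ g z := by
          rw [integral_sub (integrable_inv_sub_mul hzE' (integrable_coeFn_L2 g))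
            (integrable_finsetSum _ hterm), integral_finsetSum _ hterm, cauchyTransform_coe]
          simp only [integral_const_mul, hwg, mul_zero, Finset.sum_const_zero, sub_zero]

theorem exists_cauchyTransform_eq_zero [IsFiniteMeasure μ] {q : Polynomial ℂ} (hq : q ≠ 0)
    (hn : q.natDegree ≤ n) :
    ∃ l : Lp ℂ 2 μ →ₗ[ℂ] (Fin n → ℂ), ∀ g, l g = 0 → ∀ z ∉ E, q.eval z = 0 →
      cauchyTransform μ g z = 0 := by
  obtain ⟨r, hr⟩ := exists_fin_forall_eval_eq_zero hq hn
  have hl : ∀ i, ∃ l : Lp ℂ 2 μ →ₗ[ℂ] ℂ, r i ∉ E → ∀ g, l g = cauchyTransform μ g (r i) := by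
    intro i
    by_cases hi : r i ∈ E
    · exact ⟨0, fun h => absurd hi h⟩
    · exact ⟨weightFunctional _ fun g => integrable_inv_sub_mul hi (integrable_coeFn_L2 g),
        fun _ _ => rfl⟩
  choose l hl using hl
  refine ⟨LinearMap.pi l, fun g hg z hz hqz => ?_⟩
  obtain ⟨i, rfl⟩ := hr z hqz
  rw [← hl i hz g]
  exact congrFun hg i

/- If `φ g₀` is not integrable for some `g₀ ∈ L²(μ)`, then the operator is only defined because
`ν` is carried by `∞` and the poles of `φ`, and there are at most `n` poles. -/
theorem exists_eLpNorm_cauchyTransform_le [IsFiniteMeasure μ] {F : Set (OnePoint ℂ)}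
    (hEF : ∀ y ∈ E, (y : OnePoint ℂ) ∉ F) {ν : Measure F} {p : ℝ≥0∞}
    (hnum : φ.num.natDegree ≤ n) (hden : φ.denom.natDegree ≤ n)
    (hE : ∀ᵐ y : E ∂μ, φ.denom.eval (y : ℂ) ≠ 0) (hF : ∀ᵐ z : F ∂ν, NonvanishingAt φ z) {M : ℝ≥0∞}
    (hM : ∀ g : E → ℂ, MemLp g 2 μ →
      (∀ᵐ z : F ∂ν, Integrable (fun y : E => zolotarevKernel φ z y * g y) μ) ∧
      eLpNorm (fun z : F => ∫ y : E, zolotarevKernel φ z y * g y ∂μ) p ν ≤ M * eLpNorm g 2 μ) :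
    ∃ l : Lp ℂ 2 μ →ₗ[ℂ] (Fin n → ℂ), ∀ g, l g = 0 →
      eLpNorm (fun z : F => cauchyTransform μ g z) p ν ≤ M * eLpNorm g 2 μ := by
  have hnotE : ∀ z : F, (z : OnePoint ℂ) ∉ (↑) '' E := by
    rintro ⟨_, hz⟩ ⟨y, hy, rfl⟩
    exact hEF y hy hz
  by_cases hφ : ∀ g : Lp ℂ 2 μ, Integrable (fun y : E => φ.eval (RingHom.id ℂ) y * g y) μ
  · obtain ⟨l, hl⟩ := exists_integral_zolotarevKernel_mul_eq hnum hden hE hφ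
    refine ⟨l, fun g hg => (eLpNorm_congr_ae ?_).trans_le (hM g (Lp.memLp g)).2⟩
    filter_upwards [hF] with z hz
    exact (hl g hg z (hnotE z) hz).symm
  · obtain ⟨g₀, hg₀⟩ := not_forall.1 hφ
    obtain ⟨l, hl⟩ := exists_cauchyTransform_eq_zero (E := E) (μ := μ) φ.denom_ne_zero hden
    refine ⟨l, fun g hg => ?_⟩
    have hzero : (fun z : F => cauchyTransform μ g z) =ᵐ[ν] 0 := by
      filter_upwards [hF, (hM g₀ (Lp.memLp g₀)).1] with z hz hint
      obtain ⟨z, hzF⟩ := z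
      cases z with
      | infty => rfl
      | coe z =>
        have hzE : z ∉ E := fun h => hEF z h hzF
        exact hl g hg z hzE <| not_not.1 fun hne =>
          hg₀ (integrable_eval_mul_of_integrable_zolotarevKernel_mul hzE hz hne hint)
    rw [eLpNorm_congr_ae hzero, eLpNorm_zero]
    exact zero_le

theorem exists_eLpNorm_cauchyTransform_le_of_cauchyZolotarev_lt [IsFiniteMeasure μ]
    {F : Set (OnePoint ℂ)} (hEF : ∀ y ∈ E, (y : OnePoint ℂ) ∉ F) {ν : Measure F} {p a : ℝ≥0∞}
    (ha : cauchyZolotarev n E F p μ ν < a) :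
    ∃ l : Lp ℂ 2 μ →ₗ[ℂ] (Fin n → ℂ), ∀ g, l g = 0 →
      eLpNorm (fun z : F => cauchyTransform μ g z) p ν ≤ a * ‖g‖ₑ := by
  simp only [cauchyZolotarev, kernelNorm, iInf_lt_iff, sInf_lt_iff] at ha
  obtain ⟨φ, ⟨-, hnum, hden, hφE, hφF⟩, M, hM, hMa⟩ := ha
  obtain ⟨l, hl⟩ := exists_eLpNorm_cauchyTransform_le hEF hnum hden hφE hφF hM
  exact ⟨l, fun g hg => (hl g hg).trans (by rw [Lp.enorm_def]; gcongr)⟩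

end ZolotarevKernel

section GrothendieckDual

variable {D : Type*} {E : Set ℂ} {F : Set (OnePoint ℂ)} {Kext : D → OnePoint ℂ → ℂ}

theorem subset_compl_image_coe (hEF : ∀ y ∈ E, (y : OnePoint ℂ) ∉ F) :
    F ⊆ ((↑) '' E : Set (OnePoint ℂ))ᶜ := by
  rintro _ hz ⟨y, hy, rfl⟩
  exact hEF y hy hz

theorem exists_isGrothendieckDual_enorm_lt [MeasurableSpace D] {lam : Measure D} {ν : Measure F}
    {p : ℝ≥0∞} [Fact (1 ≤ p)] {b : ℝ≥0∞} (hb : dualNorm E F p ν lam Kext < b) :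
    ∃ T, IsGrothendieckDual E F p ν lam Kext T ∧ ‖T‖ₑ < b := by
  simpa only [dualNorm, iInf_lt_iff, exists_prop] using hb

variable [CompactSpace E] {μ : Measure E}

theorem isOpen_compl_image_coe : IsOpen ((↑) '' E : Set (OnePoint ℂ))ᶜ :=
  ((isCompact_iff_compactSpace.2 ‹_›).image OnePoint.continuous_coe).isClosed.isOpen_compl

theorem Contour.Separates.integral_mul_cauchyTransform [SFinite μ] {Γ : Contour} {F : Set ℂ}
    (hΓ : Γ.Separates E F) (hF : IsClosed F) {f : ℂ → ℂ} (hf : DifferentiableOn ℂ f Fᶜ) {g : E → ℂ}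
    (hg : Integrable g μ) :
    Γ.integral (fun z => f z * cauchyTransform μ g z) =
      2 * Real.pi * Complex.I * ∫ y : E, f y * g y ∂μ := by
  have hk : ContinuousOn (Function.uncurry fun z (y : E) => f z * ((y : ℂ) - z)⁻¹)
      (Γ.support ×ˢ univ) := by
    have hsub : Γ.support ⊆ Fᶜ := Set.subset_compl_iff_disjoint_right.2 hΓ.disjoint_right
    refine ((hf.continuousOn.mono hsub).comp continuousOn_fst fun q hq => hq.1).mul
      (.inv₀ (by fun_prop) fun q hq h => ?_)
    exact Set.disjoint_left.1 hΓ.disjoint_left hq.1 (sub_eq_zero.1 h ▸ q.2.2)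
  have hcauchy : ∀ y : E,
      Γ.integral (fun z => f z * ((y : ℂ) - z)⁻¹) = 2 * Real.pi * Complex.I * f y := fun y => by
    have hneg : ∀ z, f z * ((y : ℂ) - z)⁻¹ = -1 * (f z * (z - y)⁻¹) := fun z => by
      rw [← neg_sub z, inv_neg, mul_neg, neg_one_mul]
    simp only [hneg]
    rw [Contour.integral_const_mul, hΓ.integral_mul_inv_sub hF hf y.2]
    ring
  simp only [cauchyTransform_coe, ← MeasureTheory.integral_const_mul, ← mul_assoc]
  rw [Contour.integral_integral hg hk]
  simp only [hcauchy]

theorem dualFun_cauchyTransform [SFinite μ] (hF : IsClosed F)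
    (hanal : ∀ x, ∀ z ∈ Fᶜ, SphereAnalyticAt (Kext x) z) {Γ : Contour}
    (hΓ : Γ.Separates E ((↑) ⁻¹' F)) {g : E → ℂ} (hg : Integrable g μ) (x : D) :
    dualFun Kext Γ (cauchyTransform μ g) x = ∫ y : E, Kext x (y : ℂ) * g y ∂μ := by
  have hdiff : DifferentiableOn ℂ (fun z : ℂ => Kext x z) ((↑) ⁻¹' F)ᶜ := fun z hz =>
    (AnalyticAt.differentiableAt (hanal x z hz)).differentiableWithinAt
  rw [dualFun, hΓ.integral_mul_cauchyTransform (hF.preimage OnePoint.continuous_coe) hdiff hg,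
    inv_mul_cancel_left₀ Complex.two_pi_I_ne_zero]

variable [MetricSpace D] [CompactSpace D] [MeasurableSpace D] [BorelSpace D]
  {lam : Measure D} [IsFiniteMeasure lam] [IsFiniteMeasure μ] {ν : Measure F} {p : ℝ≥0∞}
  [Fact (1 ≤ p)] {K : C(D × E, ℂ)} {T : bergman F p ν →L[ℂ] Lp ℂ 2 lam}

theorem IsGrothendieckDual.apply_eq_kernelOp (hT : IsGrothendieckDual E F p ν lam Kext T)
    (hF : IsClosed F) (hEF : ∀ y ∈ E, (y : OnePoint ℂ) ∉ F)
    (hK : ∀ (x : D) (y : E), Kext x ((y : ℂ) : OnePoint ℂ) = K (x, y))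
    (hanal : ∀ x, ∀ z ∈ Fᶜ, SphereAnalyticAt (Kext x) z) {g : Lp ℂ 2 μ} {u : bergman F p ν}
    (hu : (u : Lp ℂ p ν) =ᵐ[ν] fun z : F => cauchyTransform μ g z) :
    T u = kernelOp lam μ K g := by
  have hg := integrable_coeFn_L2 g
  obtain ⟨Γ, hΓ⟩ := exists_contour_separates (isCompact_iff_compactSpace.2 ‹CompactSpace E›)
    (hF.preimage OnePoint.continuous_coe) (disjoint_left.2 hEF)
  have hTu := hT _ _ Γ u isOpen_compl_image_coe (subset_compl_image_coe hEF)
    (fun y hy h => h (mem_image_of_mem _ hy)) (memH_cauchyTransform hg) hΓ.admissible hu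
  refine Lp.ext (hTu.trans (.trans (.of_forall fun x => ?_) (coeFn_kernelOp μ K lam g).symm))
  simp only [dualFun_cauchyTransform hF hanal hΓ hg, kernelFun_apply, hK]

theorem IsGrothendieckDual.enorm_kernelOp_le (hT : IsGrothendieckDual E F p ν lam Kext T)
    (hF : IsClosed F) (hEF : ∀ y ∈ E, (y : OnePoint ℂ) ∉ F)
    (hK : ∀ (x : D) (y : E), Kext x ((y : ℂ) : OnePoint ℂ) = K (x, y))
    (hanal : ∀ x, ∀ z ∈ Fᶜ, SphereAnalyticAt (Kext x) z) {g : Lp ℂ 2 μ}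
    (hgp : eLpNorm (fun z : F => cauchyTransform μ g z) p ν < ⊤) :
    ‖kernelOp lam μ K g‖ₑ ≤ ‖T‖ₑ * eLpNorm (fun z : F => cauchyTransform μ g z) p ν := by
  have hH : MemH ((↑) '' E)ᶜ (cauchyTransform μ g) := memH_cauchyTransform (integrable_coeFn_L2 g)
  have hFU := subset_compl_image_coe hEF
  have hcont : Continuous fun z : F => cauchyTransform μ g z := continuous_iff_continuousAt.2
    fun z => (hH.1 z (hFU z.2)).continuousAt.comp continuous_subtype_val.continuousAt
  have hmem : MemLp (fun z : F => cauchyTransform μ g z) p ν :=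
    ⟨hcont.measurable.aestronglyMeasurable, hgp⟩
  let u : bergman F p ν := ⟨hmem.toLp _, Submodule.le_topologicalClosure _
    (Submodule.subset_span ⟨_, _, isOpen_compl_image_coe, hFU, hH, hmem.coeFn_toLp⟩)⟩
  rw [← hT.apply_eq_kernelOp hF hEF hK hanal (u := u) hmem.coeFn_toLp, ← Lp.enorm_toLp hmem]
  exact T.le_opENorm u

theorem exists_norm_kernelOp_le (hF : IsClosed F) (hEF : ∀ y ∈ E, (y : OnePoint ℂ) ∉ F)
    (hK : ∀ (x : D) (y : E), Kext x ((y : ℂ) : OnePoint ℂ) = K (x, y))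
    (hanal : ∀ x, ∀ z ∈ Fᶜ, SphereAnalyticAt (Kext x) z) {n : ℕ}
    (hZ : cauchyZolotarev n E F p μ ν ≠ ⊤) (hN : dualNorm E F p ν lam Kext ≠ ⊤) {c : ℝ}
    (hc : (cauchyZolotarev n E F p μ ν * dualNorm E F p ν lam Kext).toReal < c) :
    ∃ l : Lp ℂ 2 μ →ₗ[ℂ] (Fin n → ℂ), ∀ g, l g = 0 → ‖kernelOp lam μ K g‖ ≤ c * ‖g‖ := by
  obtain ⟨a, ha, b, hb, hab⟩ : ∃ a > cauchyZolotarev n E F p μ ν,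
      ∃ b > dualNorm E F p ν lam Kext, a * b < ENNReal.ofReal c := by
    by_contra! h
    exact ((ENNReal.lt_ofReal_iff_toReal_lt (ENNReal.mul_ne_top hZ hN)).2 hc).not_ge
      (ENNReal.le_mul_of_forall_lt (.inr hN) (.inl hZ) h)
  obtain ⟨T, hT, hTb⟩ := exists_isGrothendieckDual_enorm_lt hb
  obtain ⟨l, hl⟩ := exists_eLpNorm_cauchyTransform_le_of_cauchyZolotarev_lt hEF ha
  have ha' : a < ⊤ := ENNReal.lt_top_of_mul_ne_top_left hab.ne_top hb.ne_bot
  refine ⟨l, fun g hg => ?_⟩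
  have hle : ‖kernelOp lam μ K g‖ₑ ≤ ENNReal.ofReal c * ‖g‖ₑ := by
    calc ‖kernelOp lam μ K g‖ₑ
        ≤ ‖T‖ₑ * eLpNorm (fun z : F => cauchyTransform μ g z) p ν :=
          hT.enorm_kernelOp_le hF hEF hK hanal
            ((hl g hg).trans_lt (ENNReal.mul_lt_top ha' enorm_lt_top))
      _ ≤ b * (a * ‖g‖ₑ) := by
          gcongr
          exact hl g hg
      _ = a * b * ‖g‖ₑ := by ring
      _ ≤ ENNReal.ofReal c * ‖g‖ₑ := by gcongr
  have hc0 : 0 ≤ c := ENNReal.toReal_nonneg.trans hc.le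
  rw [← ofReal_norm, ← ofReal_norm, ← ENNReal.ofReal_mul hc0] at hle
  exact (ENNReal.ofReal_le_ofReal_iff (by positivity)).1 hle

end GrothendieckDual

end

theorem theorem1_general {D : Type*} [MetricSpace D] [CompactSpace D] [MeasurableSpace D]
    [BorelSpace D] (E : Set ℂ) [CompactSpace E] (F : Set (OnePoint ℂ)) (hF : IsClosed F)
    (hEF : ∀ y ∈ E, (y : OnePoint ℂ) ∉ F)
    (lam : Measure D) [IsFiniteMeasure lam] (μ : Measure E) [IsFiniteMeasure μ] (ν : Measure F)
    (p : ℝ≥0∞) [Fact (1 ≤ p)]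
    (K : C(D × E, ℂ)) (Kext : D → OnePoint ℂ → ℂ)
    (hK : ∀ (x : D) (y : E), Kext x ((y : ℂ) : OnePoint ℂ) = K (x, y))
    (hanal : ∀ x : D, ∀ z ∈ Fᶜ, SphereAnalyticAt (Kext x) z)
    (n : ℕ)
    (hZ : cauchyZolotarev n E F p μ ν ≠ ⊤)
    (hK' : dualNorm E F p ν lam Kext ≠ ⊤) :
    ∃ Kn : C(D × E, ℂ),
      LinearMap.rank (kernelOp lam μ Kn : Lp ℂ 2 μ →ₗ[ℂ] Lp ℂ 2 lam) ≤ n ∧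
      ‖kernelOp lam μ K - kernelOp lam μ Kn‖ₑ ≤
        cauchyZolotarev n E F p μ ν * dualNorm E F p ν lam Kext := by
  obtain ⟨Kn, hrank, hnorm⟩ := exists_kernelOp_rank_le lam μ K ENNReal.toReal_nonneg fun c hc =>
    exists_norm_kernelOp_le hF hEF hK hanal hZ hK' hc
  refine ⟨Kn, hrank, ?_⟩
  rw [← ofReal_norm, ← ENNReal.ofReal_toReal (ENNReal.mul_ne_top hZ hK')]
  exact ENNReal.ofReal_le_ofReal hnorm

theorem theorem1 {D : Type*} [MetricSpace D] [CompactSpace D] [MeasurableSpace D] [BorelSpace D]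
    (E : Set ℂ) [CompactSpace E] (F : Set (OnePoint ℂ)) (hF : IsClosed F)
    (hEF : ∀ y ∈ E, (y : OnePoint ℂ) ∉ F)
    (lam : Measure D) [IsFiniteMeasure lam] (μ : Measure E) [IsFiniteMeasure μ] (ν : Measure F)
    (p : ℝ≥0∞) [Fact (1 ≤ p)]
    (K : C(D × E, ℂ)) (Kext : D → OnePoint ℂ → ℂ)
    (hK : ∀ (x : D) (y : E), Kext x ((y : ℂ) : OnePoint ℂ) = K (x, y))
    (hcont : ContinuousOn (fun q : D × OnePoint ℂ => Kext q.1 q.2) (univ ×ˢ Fᶜ))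
    (hanal : ∀ x : D, ∀ z ∈ Fᶜ, SphereAnalyticAt (Kext x) z)
    (n : ℕ) (hn : 1 ≤ n)
    (hZ : cauchyZolotarev n E F p μ ν ≠ ⊤)
    (hK' : dualNorm E F p ν lam Kext ≠ ⊤) :
    ∃ Kn : C(D × E, ℂ),
      LinearMap.rank (kernelOp lam μ Kn : Lp ℂ 2 μ →ₗ[ℂ] Lp ℂ 2 lam) ≤ n ∧
      ‖kernelOp lam μ K - kernelOp lam μ Kn‖ₑ ≤
        cauchyZolotarev n E F p μ ν * dualNorm E F p ν lam Kext :=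
  theorem1_general E F hF hEF lam μ ν p K Kext hK hanal n hZ hK'
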